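/- Consider $n$ agents with time-varying regressors $C_i(t)\in\mathbb R^{N_y\times N}$ (measurable in $t$) and an undirected time-varying graph $\mathcal G(t)$ on $\{1,\dots,n\}$ (with measurable edge indicators), $t\ge 0$. Let $D(t)$ be an oriented incidence matrix of $\mathcal G(t)$ (entries $+1$ at the source and $-1$ at the sink of each edge, $0$ otherwise; the orientation is arbitrary) and $L(t)=D(t)D(t)^\top$ the Laplacian. Let $\alpha>0$, let $\Gamma_i\in\mathbb R^{N\times N}$ be symmetric positive definite gains, and put $\bar\Gamma=\mathrm{diag}(\Gamma_1,\dots,\Gamma_n)$, $r_1=\|\bar\Gamma\|$, $\bar C=\mathrm{diag}(C_1,\dots,C_n)$ (block diagonal) and $$\bar\Lambda(t)=\begin{bmatrix}\bar C(t)\\ \sqrt{\alpha}\,D^\top(t)\otimes I_N\end{bmatrix}.$$ Assume that there are constants $T>0$, $\bar\iota_1\ge\underline\iota_1>0$, $r_2,r_3>0$, $\underline\lambda>0$ such that * (cooperative persistent excitation) $\bar\iota_1 I_N\ge\int_{t-T}^t\sum_{i=1}^n C_i^\top(s)C_i(s)\,ds\ge\underline\iota_1 I_N$ for all $t\ge T$;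 * (bounded regressors) $\|C_i^\top(t)C_i(t)\|\le r_2$ for all $t\ge0$ and all $i$; * (connectedness on average, bounded Laplacian) for all $t\ge T$ the matrix $\int_{t-T}^tL(s)\,ds$ has exactly one zero eigenvalue, counted with multiplicity, and all its other eigenvalues are at least $\underline\lambda$; moreover $\|L(t)\|\le r_3$ for all $t\ge0$. (Norms of matrices are spectral norms.) Consider the error system $\dot{\tilde x}(t)=-\bar\Gamma\bar\Lambda^\top(t)\bar\Lambda(t)\tilde x(t)$ on $\mathbb R^{nN}$, $t\ge0$, with solutions in the sense of Carathéodory, and let $\bar\Phi(s,t)$ be its state transition matrix (from time $t$ to time $s$). Then the Peano–Baker series of the system defines $\bar\Phi(s,t)$ for all $s,t\ge0$, and: 1. The origin is globally uniformly asymptotically stable (uniformly in the initial time $t_0\ge0$). 2. With $$P(t)=\tfrac T2\bar\Gamma^{-1}+\int_{t-T}^t(s-t+T)\,\bar\Phi^\top(s,t)\bar\Lambda^\top(s)\bar\Lambda(s)\bar\Phi(s,t)\,ds,\qquad t\ge T,$$ the function $V(\tilde x,t)=\tilde x^\top P(t)\tilde x$ is a strong Lyapunov function: there are $c_1,c_2,c_3>0$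 with $c_1\|\tilde x\|^2\le V(\tilde x,t)\le c_2\|\tilde x\|^2$ for all $t\ge T$ and all $\tilde x$, and $\dot V\le-c_3\|\tilde x\|^2$ along solutions. 3. Along every solution started at a time $t_0\ge0$, $V$ is differentiable at every $t\ge\max\{T,t_0\}$ (one-sidedly at the left end point), with $$\dot V=-\tilde x^\top(t)M(t,t-T)\tilde x(t)\le-\underline\iota_3\|\tilde x(t)\|^2,\qquad M(t,t-T)=\int_{t-T}^t\bar\Phi^\top(s,t)\bar\Lambda^\top(s)\bar\Lambda(s)\bar\Phi(s,t)\,ds,$$ and $M(t,t-T)\ge\underline\iota_3 I_{nN}$ for all $t\ge T$, where, with $\bar\iota_2=T(r_2+\alpha r_3)$, $\varphi_1=\tfrac12r_1^2\bar\iota_2^2$ and $$\underline\iota_2=\min_{0\le\rho\le1}\max\Big\{\alpha\underline\lambda(1-\rho^2),\ \tfrac{\underline\iota_1}{n}\rho^2-2r_2T\sqrt{\rho^2(1-\rho^2)}\Big\},$$ the constant $\underline\iota_3>0$ is $$\underline\iota_3=\Big(\frac{\sqrt{\bar\iota_2-\underline\iota_2+\varphi_1\underline\iota_2}-\sqrt{\bar\iota_2}}{\varphi_1-1}\Big)^2\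 \text{ if }\varphi_1\ne1,\qquad \underline\iota_3=\frac{\underline\iota_2^2}{4\bar\iota_2}\ \text{ if }\varphi_1=1.$$ -/

import Mathlib

open scoped Matrix Kronecker Topology
open Set Filter MeasureTheory

noncomputable section

/-- An orientation of an undirected graph: every edge gets a source and a sink. -/
structure EdgeOrientation {n : ℕ} (G : SimpleGraph (Fin n)) where
  src : G.edgeSet → Fin n
  tgt : G.edgeSet → Fin n
  spec : ∀ e : G.edgeSet, s(src e, tgt e) = (e : Sym2 (Fin n))

open Classical in
/-- The oriented incidence matrix `D`: the entry is `1` at the source of the edge, `-1` at its sink,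
and `0` elsewhere. -/
def orientedIncidence {n : ℕ} {G : SimpleGraph (Fin n)} (o : EdgeOrientation G) :
    Matrix (Fin n) G.edgeSet ℝ :=
  Matrix.of fun i e => if i = o.src e then 1 else if i = o.tgt e then -1 else 0

open Classical in
/-- The Laplacian matrix `L = D Dᵀ`. -/
def laplacian {n : ℕ} {G : SimpleGraph (Fin n)} (o : EdgeOrientation G) :
    Matrix (Fin n) (Fin n) ℝ :=
  orientedIncidence o * (orientedIncidence o)ᵀ

/-- The block diagonal matrix with blocks `M 1, …, M n`; row `(i, k)` is row `k` of block `i`. -/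
def blockDiag {n p q : ℕ} (M : Fin n → Matrix (Fin p) (Fin q) ℝ) :
    Matrix (Fin n × Fin p) (Fin n × Fin q) ℝ :=
  (Matrix.blockDiagonal M).submatrix Prod.swap Prod.swap

/-- The stacked output matrix `Λ = [C; √α Dᵀ ⊗ I]`, where `C` is the block diagonal matrix of the
local regressors. -/
def outputMatrix {n Ny N : ℕ} (α : ℝ) (C : Fin n → Matrix (Fin Ny) (Fin N) ℝ)
    {G : SimpleGraph (Fin n)} (o : EdgeOrientation G) :
    Matrix ((Fin n × Fin Ny) ⊕ (G.edgeSet × Fin N)) (Fin n × Fin N) ℝ :=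
  Matrix.fromRows (blockDiag C)
    (Real.sqrt α • ((orientedIncidence o)ᵀ ⊗ₖ (1 : Matrix (Fin N) (Fin N) ℝ)))

open Classical in
/-- The matrix `Λᵀ Λ`. -/
def outputGram {n Ny N : ℕ} (α : ℝ) (C : Fin n → Matrix (Fin Ny) (Fin N) ℝ)
    {G : SimpleGraph (Fin n)} (o : EdgeOrientation G) :
    Matrix (Fin n × Fin N) (Fin n × Fin N) ℝ :=
  (outputMatrix α C o)ᵀ * outputMatrix α C o

/-- The system matrix `A(t) = -Γ Λ(t)ᵀ Λ(t)` of the error system. -/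
def errorMatrix {n Ny N : ℕ} (Γ : Fin n → Matrix (Fin N) (Fin N) ℝ) (α : ℝ)
    (C : ℝ → Fin n → Matrix (Fin Ny) (Fin N) ℝ) (G : ℝ → SimpleGraph (Fin n))
    (o : ∀ t, EdgeOrientation (G t)) (t : ℝ) : Matrix (Fin n × Fin N) (Fin n × Fin N) ℝ :=
  -(blockDiag Γ * outputGram α (C t) (o t))

section General

variable {ι : Type} [Fintype ι] [DecidableEq ι]

/-- The induced (spectral) matrix norm. -/
def opNorm (A : Matrix ι ι ℝ) : ℝ := ‖Matrix.toEuclideanCLM (n := ι) (𝕜 := ℝ) A‖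

/-- The entrywise integral of a matrix-valued function. -/
def matrixIntegral (F : ℝ → Matrix ι ι ℝ) (a b : ℝ) : Matrix ι ι ℝ :=
  Matrix.of fun i j => ∫ s in a..b, F s i j

/-- The quadratic form `xᵀ P x`. -/
def quadForm (P : Matrix ι ι ℝ) (x : EuclideanSpace ℝ ι) : ℝ := x.ofLp ⬝ᵥ (P *ᵥ x.ofLp)

/-- Carathéodory solutions on `[t₀, ∞)` of `x' = A(t) x`: locally absolutely continuous functions
that solve the equation almost everywhere, in integral form. -/
def IsSolution (A : ℝ → Matrix ι ι ℝ) (t₀ : ℝ) (x : ℝ → EuclideanSpace ℝ ι) : Prop :=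
  ∀ t, t₀ ≤ t →
    IntervalIntegrable (fun s => Matrix.toEuclideanCLM (n := ι) (𝕜 := ℝ) (A s) (x s)) volume t₀ t ∧
    x t = x t₀ + ∫ s in t₀..t, Matrix.toEuclideanCLM (n := ι) (𝕜 := ℝ) (A s) (x s)

/-- `Φ s t` is the state transition matrix, from time `t` to time `s` (both nonnegative, in either
order), of `x' = A(t) x`: `Φ t t = 1` and `∂Φ(s,t)/∂s = A(s) Φ(s,t)`, in integral form. -/
def IsStateTransition (A : ℝ → Matrix ι ι ℝ) (Φ : ℝ → ℝ → Matrix ι ι ℝ) : Prop :=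
  ∀ s t, 0 ≤ s → 0 ≤ t →
    (∀ i j, IntervalIntegrable (fun p => (A p * Φ p t) i j) volume t s) ∧
    Φ s t = 1 + matrixIntegral (fun p => A p * Φ p t) t s

/-- The terms of the Peano–Baker series. -/
def peanoBakerTerm (A : ℝ → Matrix ι ι ℝ) (t : ℝ) : ℕ → ℝ → Matrix ι ι ℝ
  | 0, _ => 1
  | k + 1, s => matrixIntegral (fun p => A p * peanoBakerTerm A t k p) t s

/-- The state transition matrix `Φ(s,t)` of `x' = A(t) x`, as the Peano–Baker series. -/
def transitionMatrix (A : ℝ → Matrix ι ι ℝ) (s t : ℝ) : Matrix ι ι ℝ :=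
  ∑' k, peanoBakerTerm A t k s

/-- Global uniform asymptotic stability of the origin of `x' = A(t) x`, `t ≥ 0`: uniform stability
with `δ(ε) → ∞` as `ε → ∞`, and global uniform attractivity, both uniform in the initial time. -/
def IsGUAS (A : ℝ → Matrix ι ι ℝ) : Prop :=
  (∃ δ : ℝ → ℝ, (∀ ε, 0 < ε → 0 < δ ε) ∧ Tendsto δ atTop atTop ∧
    ∀ ε, 0 < ε → ∀ t₀, 0 ≤ t₀ → ∀ x, IsSolution A t₀ x → ‖x t₀‖ < δ ε →
      ∀ t, t₀ ≤ t → ‖x t‖ < ε) ∧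
  (∀ η c : ℝ, 0 < η → 0 < c → ∃ τ : ℝ, 0 < τ ∧
    ∀ t₀, 0 ≤ t₀ → ∀ x, IsSolution A t₀ x → ‖x t₀‖ < c → ∀ t, t₀ + τ ≤ t → ‖x t‖ < η)

/-- `V` is a strong (strict) Lyapunov function, with quadratic bounds, on `[T, ∞)` for
`x' = A(t) x`: it is positive definite, decrescent and radially unbounded, and along every solution
it is differentiable (one-sidedly at the initial time) with negative definite derivative. -/
def IsStrongLyapunov (A : ℝ → Matrix ι ι ℝ) (T : ℝ) (V : ℝ → EuclideanSpace ℝ ι → ℝ) : Prop :=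
  ∃ c₁ c₂ c₃ : ℝ, 0 < c₁ ∧ 0 < c₂ ∧ 0 < c₃ ∧
    (∀ t, T ≤ t → ∀ x, c₁ * ‖x‖ ^ 2 ≤ V t x ∧ V t x ≤ c₂ * ‖x‖ ^ 2) ∧
    (∀ t₀, 0 ≤ t₀ → ∀ x, IsSolution A t₀ x → ∀ t, max T t₀ ≤ t →
      ∃ d, HasDerivWithinAt (fun τ => V τ (x τ)) d (Ici (max T t₀)) t ∧ d ≤ -c₃ * ‖x t‖ ^ 2)

end General

/-- The integrand `f(s,t) = Φ(s,t)ᵀ Λ(s)ᵀ Λ(s) Φ(s,t)`, with `Φ` the state transition matrix of the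
error system. -/
def gramIntegrand {n Ny N : ℕ} (Γ : Fin n → Matrix (Fin N) (Fin N) ℝ) (α : ℝ)
    (C : ℝ → Fin n → Matrix (Fin Ny) (Fin N) ℝ) (G : ℝ → SimpleGraph (Fin n))
    (o : ∀ t, EdgeOrientation (G t)) (s t : ℝ) : Matrix (Fin n × Fin N) (Fin n × Fin N) ℝ :=
  (transitionMatrix (errorMatrix Γ α C G o) s t)ᵀ * outputGram α (C s) (o s) *
    transitionMatrix (errorMatrix Γ α C G o) s t

/-- The observability Gramian `M(t, t-T)` of the error system. -/
def obsGramian {n Ny N : ℕ} (Γ : Fin n → Matrix (Fin N) (Fin N) ℝ) (α : ℝ)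
    (C : ℝ → Fin n → Matrix (Fin Ny) (Fin N) ℝ) (G : ℝ → SimpleGraph (Fin n))
    (o : ∀ t, EdgeOrientation (G t)) (T t : ℝ) : Matrix (Fin n × Fin N) (Fin n × Fin N) ℝ :=
  matrixIntegral (fun s => gramIntegrand Γ α C G o s t) (t - T) t

/-- The matrix `P(t) = (T/2) Γ⁻¹ + ∫_{t-T}^t (s-t+T) f(s,t) ds`. -/
def lyapunovMatrix {n Ny N : ℕ} (Γ : Fin n → Matrix (Fin N) (Fin N) ℝ) (α : ℝ)
    (C : ℝ → Fin n → Matrix (Fin Ny) (Fin N) ℝ) (G : ℝ → SimpleGraph (Fin n))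
    (o : ∀ t, EdgeOrientation (G t)) (T t : ℝ) : Matrix (Fin n × Fin N) (Fin n × Fin N) ℝ :=
  (T / 2) • (blockDiag Γ)⁻¹ +
    matrixIntegral (fun s => (s - t + T) • gramIntegrand Γ α C G o s t) (t - T) t

/-- The averaged Laplacian `∫_{t-T}^t L(s) ds`. -/
def avgLaplacian {n : ℕ} (G : ℝ → SimpleGraph (Fin n)) (o : ∀ t, EdgeOrientation (G t))
    (T t : ℝ) : Matrix (Fin n) (Fin n) ℝ :=
  matrixIntegral (fun s => laplacian (o s)) (t - T) t

theorem avgLaplacian_isHermitian {n : ℕ} (G : ℝ → SimpleGraph (Fin n))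
    (o : ∀ t, EdgeOrientation (G t)) (T t : ℝ) : (avgLaplacian G o T t).IsHermitian := by
  ext i j
  simp [avgLaplacian, matrixIntegral, laplacian, Matrix.mul_apply, mul_comm]

/-- The integrated excitation `∫_{t-T}^t ∑ᵢ Cᵢ(s)ᵀ Cᵢ(s) ds`. -/
def excitation {n Ny N : ℕ} (C : ℝ → Fin n → Matrix (Fin Ny) (Fin N) ℝ) (T t : ℝ) :
    Matrix (Fin N) (Fin N) ℝ :=
  matrixIntegral (fun s => ∑ i, (C s i)ᵀ * C s i) (t - T) t

/-- The constant `ῑ₂ = T (r₂ + α r₃)`. -/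
def iotaTwoUpper (T α r₂ r₃ : ℝ) : ℝ := T * (r₂ + α * r₃)

/-- The constant `ι̲₂`: the minimum over `ρ = ‖a‖ ∈ [0, 1]` of
`max {α λ (1 - ρ²), (ι₁/n) ρ² - 2 r₂ T √(ρ² (1 - ρ²))}`. -/
def iotaTwoLower (n : ℕ) (T α ι₁ r₂ lam : ℝ) : ℝ :=
  sInf ((fun ρ : ℝ => max (α * lam * (1 - ρ ^ 2))
    (ι₁ / n * ρ ^ 2 - 2 * r₂ * T * Real.sqrt (ρ ^ 2 * (1 - ρ ^ 2)))) '' Icc 0 1)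

open Classical in
/-- The constant `ι̲₃`, as a function of `ῑ₂` (`u`), `ι̲₂` (`l`) and `r₁`, with
`φ₁ = r₁² ῑ₂² / 2`. -/
def iotaThreeLower (u l r₁ : ℝ) : ℝ :=
  if r₁ ^ 2 * u ^ 2 / 2 = 1 then l ^ 2 / (4 * u)
  else ((Real.sqrt (u - l + r₁ ^ 2 * u ^ 2 / 2 * l) - Real.sqrt u) / (r₁ ^ 2 * u ^ 2 / 2 - 1)) ^ 2

end

/-! Write B for the block diagonal gain and Q = ΛᵀΛ; the error system is the gradient flow y' = -B
Q(t) y. Its energy E = yᵀB⁻¹y has rate E' = -2g with g = yᵀQy. Along a solution, V is (T/2)E plus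
the ramp-weighted integral of g over [t-T, t]. Integrating the ramp by parts with the primitive H of
g, the terms in T·H(t) cancel and V becomes a constant minus ∫_{t-T}^t H. So V is C¹ although g is
only measurable, and V' = -∫_{t-T}^t g = -xᵀMx (`hasDerivAt_energy_add_ramp`). Everything then rests
on a lower bound for M, proved in two stages.

Frozen vector (`iotaTwoLower_mul_le_integral_outputGram`). Split v into its average a over the
agents and a disagreement e, and put p = n|a|², q = |e|². The averaged network dissipates at least
αλq. The regressors contribute at least (ι₁/n)p - 2r₂T√(pq), since excitation acts on a and the
cross terms obey Cauchy–Schwarz. Both contributions are nonnegative, so their sum dominates the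
larger of the two bounds; minimising over the ratio p : q gives ι̲₂|v|².

Moving vector (`IsGradientSystem.observability`). On the window, y(t) - y(s) is controlled by the
dissipated energy itself, so replacing y(t) by y(s) costs at most a factor (1 + √φ₁)², where φ₁ =
r₁²ῑ₂²/2. Hence M ≥ ι̲₂/(1 + √φ₁)², and `iotaThreeLower_mul_le` shows that the stated ι̲₃ does not
exceed this.

The same bound makes E contract by a fixed factor over each window of length T, which gives uniform
asymptotic stability (`IsGradientSystem.isGUAS`). -/

/-! ### Linear Carathéodory equations and the Peano–Baker series. -/

section LinearODE

open scoped Interval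

/-- A bounded measurable function is interval integrable. -/
theorem intervalIntegrable_of_measurable_of_abs_le {f : ℝ → ℝ} {K a b : ℝ} (hf : Measurable f)
    (hK : ∀ t ∈ Ι a b, |f t| ≤ K) : IntervalIntegrable f volume a b :=
  (intervalIntegrable_const (c := K)).mono_fun hf.aestronglyMeasurable <| by
    filter_upwards [ae_restrict_mem measurableSet_uIoc] with t ht
    simpa using (hK t ht).trans (le_abs_self K)

/-- The Picard iteration step: each integration raises the power by one and divides by k + 1, which
builds up k!. It holds for either order of the end points. -/
theorem abs_intervalIntegral_le_pow {f : ℝ → ℝ} {a b c : ℝ} {k : ℕ}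
    (hf : ∀ p ∈ Ι a b, |f p| ≤ c * |p - a| ^ k) :
    |∫ p in a..b, f p| ≤ c * (|b - a| ^ (k + 1) / (k + 1)) := by
  have hg : IntegrableOn (fun p => c * |p - a| ^ k) (Ι a b) :=
    intervalIntegrable_iff.mp (Continuous.intervalIntegrable (by fun_prop) a b)
  rw [← integral_pow_abs_sub_uIoc, ← integral_const_mul, ← Real.norm_eq_abs,
    intervalIntegral.norm_intervalIntegral_eq]
  refine norm_integral_le_of_norm_le hg ?_
  filter_upwards [ae_restrict_mem measurableSet_uIoc] with p hp using hf p hp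

variable {ι : Type} [Fintype ι]

/-- The function `y : ℝ → ℝ^ι` is a Carathéodory solution of `y' = A(t) y` on the whole line. -/
structure IsTrajectory (A : ℝ → Matrix ι ι ℝ) (y : ℝ → ι → ℝ) : Prop where
  continuous : ∀ i, Continuous fun s => y s i
  eq_add_integral : ∀ a s i, y s i = y a i + ∫ p in a..s, (A p *ᵥ y p) i

variable {A : ℝ → Matrix ι ι ℝ} {K : ℝ}

theorem abs_mulVec_le {M : Matrix ι ι ℝ} (hM : ∀ i j, |M i j| ≤ K) {v : ι → ℝ} {c : ℝ}
    (hv : ∀ j, |v j| ≤ c) (i : ι) : |(M *ᵥ v) i| ≤ Fintype.card ι * K * c := by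
  have hK : 0 ≤ K := (abs_nonneg _).trans (hM i i)
  calc |(M *ᵥ v) i| ≤ ∑ j, |M i j * v j| := Finset.abs_sum_le_sum_abs _ _
    _ ≤ ∑ _j : ι, K * c := Finset.sum_le_sum fun j _ => by
        rw [abs_mul]; exact mul_le_mul (hM i j) (hv j) (abs_nonneg _) hK
    _ = Fintype.card ι * K * c := by simp [mul_assoc]

theorem intervalIntegrable_mulVec (hA : ∀ i j, Measurable fun t => A t i j)
    (hK : ∀ t i j, |A t i j| ≤ K) {y : ℝ → ι → ℝ} (hy : ∀ i, Continuous fun s => y s i)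
    (i : ι) (a b : ℝ) : IntervalIntegrable (fun p => (A p *ᵥ y p) i) volume a b := by
  simp only [Matrix.mulVec, dotProduct]
  have := IntervalIntegrable.sum (μ := volume) (a := a) (b := b) Finset.univ
    (f := fun j p => A p i j * y p j) fun j _ =>
      (intervalIntegrable_of_measurable_of_abs_le (hA i j) fun t _ => hK t i j).mul_continuousOn
        (hy j).continuousOn
  exact this.congr fun p _ => by simp

/-- Uniqueness of Carathéodory solutions, in the form of an integral inequality. -/
theorem eq_zero_of_eq_integral (hK : ∀ t i j, |A t i j| ≤ K) {z : ℝ → ι → ℝ} {a b c : ℝ}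
    (hz : ∀ s ∈ uIcc a b, ∀ i, |z s i| ≤ c)
    (hint : ∀ s ∈ uIcc a b, ∀ i, z s i = ∫ p in a..s, (A p *ᵥ z p) i) : z b = 0 := by
  ext i
  -- Reinserting the bound into the integral equation k times gains the factor 1/k!, and letting k →
  -- ∞ forces z = 0. This replaces Grönwall and works forwards and backwards in time.
  have key : ∀ k : ℕ, ∀ s ∈ uIcc a b, ∀ i,
      |z s i| ≤ c * (Fintype.card ι * K) ^ k / k.factorial * |s - a| ^ k := by
    intro k
    induction k with
    | zero => intro s hs i; simpa using hz s hs i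
    | succ k ih =>
      intro s hs i
      have hsub : Ι a s ⊆ uIcc a b :=
        uIoc_subset_uIcc.trans (uIcc_subset_uIcc left_mem_uIcc hs)
      rw [hint s hs i]
      refine (abs_intervalIntegral_le_pow (k := k)
        (c := Fintype.card ι * K * (c * (Fintype.card ι * K) ^ k / k.factorial))
        fun p hp => ?_).trans_eq ?_
      · rw [mul_assoc]
        exact abs_mulVec_le (hK p) (fun j => ih p (hsub hp) j) i
      · rw [Nat.factorial_succ]; push_cast; field_simp; ring
  have hlim := (FloorSemiring.tendsto_pow_div_factorial_atTop
    (Fintype.card ι * K * |b - a|)).const_mul c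
  rw [mul_zero] at hlim
  refine abs_eq_zero.mp (le_antisymm (ge_of_tendsto' hlim fun k => ?_) (abs_nonneg _))
  refine (key k b right_mem_uIcc i).trans_eq ?_
  rw [mul_pow _ |b - a|]; ring

theorem IsTrajectory.unique (hA : ∀ i j, Measurable fun t => A t i j)
    (hK : ∀ t i j, |A t i j| ≤ K) {y z : ℝ → ι → ℝ} (hy : IsTrajectory A y)
    (hz : IsTrajectory A z) {a : ℝ} (h : y a = z a) : y = z := by
  ext1 b
  have hcont : Continuous fun s => y s - z s :=
    (continuous_pi hy.continuous).sub (continuous_pi hz.continuous)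
  obtain ⟨c, hc⟩ := (isCompact_uIcc (a := a) (b := b)).exists_bound_of_continuousOn
    hcont.continuousOn
  refine sub_eq_zero.mp (eq_zero_of_eq_integral (z := fun s => y s - z s) hK (a := a) (c := c)
    (fun s hs i => (norm_le_pi_norm _ i).trans (hc s hs)) fun s _ i => ?_)
  simp only [Pi.sub_apply, Matrix.mulVec_sub]
  rw [intervalIntegral.integral_sub (intervalIntegrable_mulVec hA hK hy.continuous i a s)
    (intervalIntegrable_mulVec hA hK hz.continuous i a s), hy.eq_add_integral a s i,
    hz.eq_add_integral a s i, h]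
  ring

theorem mul_apply_eq_mulVec (M P : Matrix ι ι ℝ) (i j : ι) :
    (M * P) i j = (M *ᵥ fun l => P l j) i := rfl

variable [DecidableEq ι]

/-- One induction proves both claims; continuity of a term makes the integrand of the next one
integrable. -/
theorem peanoBakerTerm_continuous_and_abs_le (hA : ∀ i j, Measurable fun t => A t i j)
    (hK : ∀ t i j, |A t i j| ≤ K) (t : ℝ) (k : ℕ) :
    (∀ i j, Continuous fun s => peanoBakerTerm A t k s i j) ∧
    ∀ s i j, |peanoBakerTerm A t k s i j| ≤
      (Fintype.card ι * K) ^ k / k.factorial * |s - t| ^ k := by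
  induction k with
  | zero =>
    refine ⟨fun i j => by simpa [peanoBakerTerm] using continuous_const, fun s i j => ?_⟩
    simp only [peanoBakerTerm, Matrix.one_apply]
    split_ifs <;> simp
  | succ k ih =>
    refine ⟨fun i j => ?_, fun s i j => ?_⟩
    · simp only [peanoBakerTerm, matrixIntegral, Matrix.of_apply, mul_apply_eq_mulVec]
      exact intervalIntegral.continuous_primitive
        (fun a b => intervalIntegrable_mulVec hA hK (fun l => ih.1 l j) i a b) t
    · simp only [peanoBakerTerm, matrixIntegral, Matrix.of_apply, mul_apply_eq_mulVec]
      refine (abs_intervalIntegral_le_pow (k := k)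
        (c := Fintype.card ι * K * ((Fintype.card ι * K) ^ k / k.factorial))
        fun p _ => ?_).trans_eq ?_
      · rw [mul_assoc]
        exact abs_mulVec_le (hK p) (fun l => ih.2 p l j) i
      · rw [Nat.factorial_succ]; push_cast; field_simp; ring

theorem abs_peanoBakerTerm_le (hA : ∀ i j, Measurable fun t => A t i j)
    (hK : ∀ t i j, |A t i j| ≤ K) {s t R : ℝ} (hs : |s - t| ≤ R) (k : ℕ) (i j : ι) :
    |peanoBakerTerm A t k s i j| ≤ (Fintype.card ι * K * R) ^ k / k.factorial := by
  have hK0 : 0 ≤ K := (abs_nonneg _).trans (hK 0 i i)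
  refine ((peanoBakerTerm_continuous_and_abs_le hA hK t k).2 s i j).trans ?_
  rw [mul_pow _ R, mul_div_right_comm]
  gcongr

theorem hasSum_transitionMatrix (hA : ∀ i j, Measurable fun t => A t i j)
    (hK : ∀ t i j, |A t i j| ≤ K) (s t : ℝ) (i j : ι) :
    HasSum (fun k => peanoBakerTerm A t k s i j) (transitionMatrix A s t i j) := by
  have hs : Summable fun k => peanoBakerTerm A t k s := by
    refine Pi.summable.mpr fun i => Pi.summable.mpr fun j => ?_
    exact Summable.of_norm_bounded (Real.summable_pow_div_factorial _)
      fun k => abs_peanoBakerTerm_le hA hK le_rfl k i j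
  exact Pi.hasSum.mp (Pi.hasSum.mp hs.hasSum i) j

theorem abs_transitionMatrix_le (hA : ∀ i j, Measurable fun t => A t i j)
    (hK : ∀ t i j, |A t i j| ≤ K) {s t R : ℝ} (hs : |s - t| ≤ R) (i j : ι) :
    |transitionMatrix A s t i j| ≤ Real.exp (Fintype.card ι * K * R) := by
  rw [← (hasSum_transitionMatrix hA hK s t i j).tsum_eq, Real.exp_eq_exp_ℝ]
  exact tsum_of_norm_bounded (f := fun k => peanoBakerTerm A t k s i j)
    (NormedSpace.expSeries_div_hasSum_exp _) fun k => abs_peanoBakerTerm_le hA hK hs k i j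

theorem transitionMatrix_continuous (hA : ∀ i j, Measurable fun t => A t i j)
    (hK : ∀ t i j, |A t i j| ≤ K) (t : ℝ) (i j : ι) :
    Continuous fun s => transitionMatrix A s t i j := by
  rw [← continuousOn_univ]
  have : (univ : Set ℝ) = ⋃ n : ℕ, Metric.ball t n := by rw [Metric.iUnion_ball_nat]
  rw [this]
  -- The series converges uniformly only on bounded sets, so continuity is proved on balls that
  -- exhaust the line.
  refine ContinuousOn.iUnion_of_isOpen (fun n => ?_) fun n => Metric.isOpen_ball
  refine (tendstoUniformlyOn_tsum
    (Real.summable_pow_div_factorial (Fintype.card ι * K * n)) (s := Metric.ball t (n : ℝ))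
    (f := fun k s => peanoBakerTerm A t k s i j) fun k s hs =>
      abs_peanoBakerTerm_le hA hK (by simpa [Real.dist_eq] using (Metric.mem_ball.mp hs).le) k i j)
    |>.continuousOn (Frequently.of_forall fun F => ?_) |>.congr fun s _ =>
      (hasSum_transitionMatrix hA hK s t i j).tsum_eq.symm
  exact continuousOn_finsetSum _ fun k _ =>
    ((peanoBakerTerm_continuous_and_abs_le hA hK t k).1 i j).continuousOn

/-- Termwise integration, justified by dominated convergence against the exponential series, shifts
the series by one index; the term lost is the identity. -/
theorem transitionMatrix_eq_add_integral (hA : ∀ i j, Measurable fun t => A t i j)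
    (hK : ∀ t i j, |A t i j| ≤ K) (s t : ℝ) (i j : ι) :
    transitionMatrix A s t i j = (1 : Matrix ι ι ℝ) i j +
      ∫ p in t..s, (A p * transitionMatrix A p t) i j := by
  have hcont : ∀ k i j, Continuous fun s => peanoBakerTerm A t k s i j := fun k =>
    (peanoBakerTerm_continuous_and_abs_le hA hK t k).1
  have h1 : HasSum (fun k => ∫ p in t..s, (A p * peanoBakerTerm A t k p) i j)
      (∫ p in t..s, (A p * transitionMatrix A p t) i j) := by
    refine intervalIntegral.hasSum_integral_of_dominated_convergence
      (fun k _ => Fintype.card ι * K * ((Fintype.card ι * K * |s - t|) ^ k / k.factorial))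
      (fun k => ?_) (fun k => ?_) ?_ intervalIntegrable_const ?_
    · exact (intervalIntegrable_iff.mp
        (intervalIntegrable_mulVec hA hK (fun l => hcont k l j) i t s)).aestronglyMeasurable
    · refine Eventually.of_forall fun p hp => abs_mulVec_le (hK p) (fun l => ?_) i
      exact abs_peanoBakerTerm_le hA hK (abs_sub_left_of_mem_uIcc (uIoc_subset_uIcc hp)) k l j
    · exact Eventually.of_forall fun _ _ => (Real.summable_pow_div_factorial _).mul_left _
    · refine Eventually.of_forall fun p _ => ?_
      simp only [Matrix.mul_apply]
      exact hasSum_sum fun l _ => (hasSum_transitionMatrix hA hK p t l j).mul_left _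
  have h2 := hasSum_transitionMatrix hA hK s t i j
  have h3 := (hasSum_nat_add_iff' 1).mpr h2
  simp only [Finset.sum_range_one] at h3
  have := h3.unique h1
  simp only [peanoBakerTerm] at this
  linarith

theorem isTrajectory_transitionMatrix (hA : ∀ i j, Measurable fun t => A t i j)
    (hK : ∀ t i j, |A t i j| ≤ K) (t : ℝ) (v : ι → ℝ) :
    IsTrajectory A fun s => transitionMatrix A s t *ᵥ v := by
  have hcont : ∀ i, Continuous fun s => (transitionMatrix A s t *ᵥ v) i := fun i => by
    simp only [Matrix.mulVec, dotProduct]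
    exact continuous_finsetSum _ fun j _ =>
      (transitionMatrix_continuous hA hK t i j).mul continuous_const
  have hbase : ∀ s i, (transitionMatrix A s t *ᵥ v) i =
      v i + ∫ p in t..s, (A p *ᵥ (transitionMatrix A p t *ᵥ v)) i := by
    intro s i
    have hii : ∀ j, IntervalIntegrable (fun p => (A p * transitionMatrix A p t) i j * v j)
        volume t s := fun j =>
      (intervalIntegrable_mulVec hA hK
        (fun l => transitionMatrix_continuous hA hK t l j) i t s).mul_const _
    have h1 : ∀ p, (A p *ᵥ (transitionMatrix A p t *ᵥ v)) i =
        ∑ j, (A p * transitionMatrix A p t) i j * v j := fun p => by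
      rw [Matrix.mulVec_mulVec]; rfl
    simp only [h1]
    rw [intervalIntegral.integral_finsetSum fun j _ => hii j]
    simp only [intervalIntegral.integral_mul_const]
    conv_lhs => simp only [Matrix.mulVec, dotProduct, transitionMatrix_eq_add_integral hA hK s t]
    simp only [add_mul, Finset.sum_add_distrib]
    congr 1
    simp [Matrix.one_apply]
  refine ⟨hcont, fun a s i => ?_⟩
  have hii := intervalIntegrable_mulVec hA hK hcont i
  rw [hbase s i, hbase a i, add_assoc,
    intervalIntegral.integral_add_adjacent_intervals (hii t a) (hii a s)]

theorem transitionMatrix_self (A : ℝ → Matrix ι ι ℝ) (t : ℝ) : transitionMatrix A t t = 1 := by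
  rw [transitionMatrix, tsum_eq_single 0]
  · rfl
  · intro k hk
    obtain ⟨k, rfl⟩ := Nat.exists_eq_succ_of_ne_zero hk
    ext i j
    simp [peanoBakerTerm, matrixIntegral]

/-- Peano–Baker series depend only on the coefficients on an interval containing both times. -/
theorem transitionMatrix_congr {A A' : ℝ → Matrix ι ι ℝ} {S : Set ℝ} (hS : S.OrdConnected)
    (h : EqOn A A' S) {s t : ℝ} (hs : s ∈ S) (ht : t ∈ S) :
    transitionMatrix A s t = transitionMatrix A' s t := by
  have : ∀ k, ∀ s ∈ S, peanoBakerTerm A t k s = peanoBakerTerm A' t k s := by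
    intro k
    induction k with
    | zero => intros; rfl
    | succ k ih =>
      intro s hs
      ext i j
      simp only [peanoBakerTerm, matrixIntegral, Matrix.of_apply]
      refine intervalIntegral.integral_congr fun p hp => ?_
      have hp' : p ∈ S := hS.uIcc_subset ht hs hp
      simp only [h hp', ih p hp']
  exact tsum_congr fun k => this k s hs

/-- A Carathéodory solution on `[t₀, ∞)` is given by the transition matrix. -/
theorem IsSolution.eq_transitionMatrix (hA : ∀ i j, Measurable fun t => A t i j)
    (hK : ∀ t i j, |A t i j| ≤ K) {t₀ : ℝ} {x : ℝ → EuclideanSpace ℝ ι}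
    (hx : IsSolution A t₀ x) {t : ℝ} (ht : t₀ ≤ t) :
    (x t).ofLp = transitionMatrix A t t₀ *ᵥ (x t₀).ofLp := by
  have htraj := isTrajectory_transitionMatrix hA hK t₀ (x t₀).ofLp
  have hcoord : ∀ s, t₀ ≤ s → ∀ i,
      IntervalIntegrable (fun p => (A p *ᵥ (x p).ofLp) i) volume t₀ s ∧
      x s i = x t₀ i + ∫ p in t₀..s, (A p *ᵥ (x p).ofLp) i := by
    intro s hs i
    obtain ⟨hi, he⟩ := hx s hs
    refine ⟨⟨(EuclideanSpace.proj (𝕜 := ℝ) i).integrable_comp hi.1,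
      (EuclideanSpace.proj (𝕜 := ℝ) i).integrable_comp hi.2⟩, ?_⟩
    have h1 := (EuclideanSpace.proj (𝕜 := ℝ) i).intervalIntegral_comp_comm hi
    have h2 := congrArg (EuclideanSpace.proj (𝕜 := ℝ) i) he
    rw [map_add, ← h1] at h2
    exact h2
  -- A solution is only given in integral form; its continuity, hence its boundedness on [t₀, t],
  -- must be recovered before uniqueness applies.
  have hxc : ContinuousOn (fun s => (x s).ofLp) (uIcc t₀ t) := by
    rw [uIcc_of_le ht]
    refine continuousOn_pi.mpr fun i => ?_
    refine ContinuousOn.congr (f := fun s => x t₀ i + ∫ p in t₀..s, (A p *ᵥ (x p).ofLp) i) ?_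
      fun s hs => (hcoord s hs.1 i).2
    refine continuousOn_const.add ?_
    have := intervalIntegral.continuousOn_primitive_interval
      ((intervalIntegrable_iff_integrableOn_Icc_of_le ht).mp (hcoord t ht i).1 |>.congr_set_ae
        (by rw [uIcc_of_le ht]; exact EventuallyEq.rfl))
    rwa [uIcc_of_le ht] at this
  have hcont : ContinuousOn (fun s => (x s).ofLp - transitionMatrix A s t₀ *ᵥ (x t₀).ofLp)
      (uIcc t₀ t) := hxc.sub (continuous_pi htraj.continuous).continuousOn
  obtain ⟨c, hc⟩ := isCompact_uIcc.exists_bound_of_continuousOn hcont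
  refine sub_eq_zero.mp (eq_zero_of_eq_integral
    (z := fun s => (x s).ofLp - transitionMatrix A s t₀ *ᵥ (x t₀).ofLp) hK (a := t₀) (c := c)
    (fun s hs i => (norm_le_pi_norm _ i).trans (hc s hs)) fun s hs i => ?_)
  have hs' : t₀ ≤ s := by rw [uIcc_of_le ht] at hs; exact hs.1
  simp only [Pi.sub_apply, Matrix.mulVec_sub]
  rw [intervalIntegral.integral_sub (hcoord s hs' i).1
    (intervalIntegrable_mulVec hA hK htraj.continuous i t₀ s), (hcoord s hs' i).2,
    htraj.eq_add_integral t₀ s i, transitionMatrix_self, Matrix.one_mulVec]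
  ring

end LinearODE

/-! ### Calculus of primitives and the derivative of the Lyapunov function. -/

section Primitives

/-- The product rule for primitives of locally integrable functions. -/
theorem mul_sub_mul_eq_integral {f g φ ψ : ℝ → ℝ} {a b : ℝ}
    (hφ : IntervalIntegrable φ volume a b) (hψ : IntervalIntegrable ψ volume a b)
    (hf : ∀ s, f s = f a + ∫ p in a..s, φ p) (hg : ∀ s, g s = g a + ∫ p in a..s, ψ p) :
    f b * g b - f a * g a = ∫ p in a..b, (φ p * g p + f p * ψ p) := by
  -- Primitives of integrable functions are absolutely continuous with the expected derivative
  -- almost everywhere, so no continuity of φ or ψ is needed.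
  have hac : ∀ {F Φ : ℝ → ℝ}, IntervalIntegrable Φ volume a b →
      (∀ s, F s = F a + ∫ p in a..s, Φ p) → AbsolutelyContinuousOnInterval F a b := by
    intro F Φ hΦ hF
    have h := (LipschitzWith.const (F a)).lipschitzOnWith (s := uIcc a b)
      |>.absolutelyContinuousOnInterval.add
        (hΦ.absolutelyContinuousOnInterval_intervalIntegral left_mem_uIcc)
    have hFe : F = (fun _ => F a) + fun s => ∫ p in a..s, Φ p := funext hF
    rw [hFe]; exact h
  have hder : ∀ {F Φ : ℝ → ℝ}, IntervalIntegrable Φ volume a b →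
      (∀ s, F s = F a + ∫ p in a..s, Φ p) → ∀ᵐ p, p ∈ uIcc a b → deriv F p = Φ p := by
    intro F Φ hΦ hF
    filter_upwards [hΦ.ae_hasDerivAt_integral] with p hp hpm
    have := (hp hpm a left_mem_uIcc).const_add (F a)
    rw [← show F = fun s => F a + ∫ p in a..s, Φ p from funext hF] at this
    exact this.deriv
  rw [← (hac hφ hf).integral_deriv_mul_eq_sub (hac hψ hg)]
  refine intervalIntegral.integral_congr_ae ?_
  filter_upwards [hder hφ hf, hder hψ hg] with p h1 h2 hp
  rw [h1 (uIoc_subset_uIcc hp), h2 (uIoc_subset_uIcc hp)]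

variable {g : ℝ → ℝ}

/-- Integration by parts: the ramp vanishes at t - T, equals T at t, and has slope one. -/
theorem integral_ramp_mul (hg : ∀ a b, IntervalIntegrable g volume a b) (T t : ℝ) :
    ∫ s in (t - T)..t, (s - t + T) * g s =
      T * (∫ p in (0 : ℝ)..t, g p) - ∫ s in (t - T)..t, ∫ p in (0 : ℝ)..s, g p := by
  have hH : Continuous fun s => ∫ p in (0 : ℝ)..s, g p :=
    intervalIntegral.continuous_primitive hg 0
  have h := mul_sub_mul_eq_integral (a := t - T) (b := t) (f := fun s => s - t + T)
    (g := fun s => ∫ p in (0 : ℝ)..s, g p) (φ := fun _ => 1) (ψ := g)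
    intervalIntegrable_const (hg _ _) (fun s => by simp; ring)
    (fun s => (intervalIntegral.integral_add_adjacent_intervals (hg _ _) (hg _ _)).symm)
  rw [intervalIntegral.integral_add] at h
  · simp only [one_mul] at h
    rw [sub_self, zero_add, show t - T - t + T = 0 by ring, zero_mul] at h
    linarith
  · simpa using hH.intervalIntegrable _ _
  · exact (hg _ _).continuousOn_mul (Continuous.continuousOn (by fun_prop))

/-- An energy with dissipation rate `2 g`, augmented by the ramp-weighted window integral of `g`, is
continuously differentiable. -/
theorem hasDerivAt_energy_add_ramp (hg : ∀ a b, IntervalIntegrable g volume a b) {E : ℝ → ℝ}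
    (hE : ∀ a b, E b - E a = -2 * ∫ p in a..b, g p) (T t : ℝ) :
    HasDerivAt (fun τ => T / 2 * E τ + ∫ s in (τ - T)..τ, (s - τ + T) * g s)
      (-∫ s in (t - T)..t, g s) t := by
  have hH : Continuous fun s => ∫ p in (0 : ℝ)..s, g p :=
    intervalIntegral.continuous_primitive hg 0
  -- The energy contributes -T·H(τ), with H the primitive of g, and cancels the boundary term of the
  -- ramp. What remains is a window integral of the continuous function H.
  have heq : (fun τ => T / 2 * E τ + ∫ s in (τ - T)..τ, (s - τ + T) * g s) = fun τ =>
      T / 2 * E 0 - ((∫ s in (0 : ℝ)..τ, ∫ p in (0 : ℝ)..s, g p) -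
        ∫ s in (0 : ℝ)..(τ - T), ∫ p in (0 : ℝ)..s, g p) := by
    ext τ
    rw [integral_ramp_mul hg, intervalIntegral.integral_interval_sub_left
      (hH.intervalIntegrable _ _) (hH.intervalIntegrable _ _)]
    linear_combination T / 2 * hE 0 τ
  have hprim : ∀ τ, HasDerivAt (fun τ => ∫ s in (0 : ℝ)..τ, ∫ p in (0 : ℝ)..s, g p)
      (∫ p in (0 : ℝ)..τ, g p) τ := fun τ =>
    intervalIntegral.integral_hasDerivAt_right (hH.intervalIntegrable _ _)
      (hH.stronglyMeasurableAtFilter _ _) hH.continuousAt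
  have h2 := (hprim (t - T)).comp_sub_const t T
  rw [heq]
  have h3 := ((hprim t).sub h2).const_sub (T / 2 * E 0)
  rwa [intervalIntegral.integral_interval_sub_left (hg _ _) (hg _ _)] at h3

end Primitives

/-! ### Inequalities for quadratic forms. -/

section QuadraticForms

variable {ι : Type} [Fintype ι]

theorem dotProduct_mulVec_comm_of_isSymm {S : Matrix ι ι ℝ} (hS : Sᵀ = S) (v w : ι → ℝ) :
    v ⬝ᵥ S *ᵥ w = w ⬝ᵥ S *ᵥ v := by
  rw [Matrix.dotProduct_mulVec, dotProduct_comm, ← Matrix.mulVec_transpose, hS]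

theorem quadratic_combination {S : Matrix ι ι ℝ} (hS : Sᵀ = S) (a c : ℝ) (v w : ι → ℝ) :
    (a • v + c • w) ⬝ᵥ S *ᵥ (a • v + c • w) =
      a ^ 2 * (v ⬝ᵥ S *ᵥ v) + 2 * a * c * (v ⬝ᵥ S *ᵥ w) + c ^ 2 * (w ⬝ᵥ S *ᵥ w) := by
  simp only [Matrix.mulVec_add, Matrix.mulVec_smul, dotProduct_add, add_dotProduct,
    dotProduct_smul, smul_dotProduct, smul_eq_mul, dotProduct_mulVec_comm_of_isSymm hS w v]
  ring

theorem Matrix.PosSemidef.transpose_eq {ι : Type} {S : Matrix ι ι ℝ} (hS : S.PosSemidef) : Sᵀ = S := by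
  have := hS.isHermitian
  rwa [Matrix.IsHermitian, Matrix.conjTranspose_eq_transpose_of_trivial] at this

theorem Matrix.PosSemidef.quadratic_nonneg {S : Matrix ι ι ℝ} (hS : S.PosSemidef) (v : ι → ℝ) :
    0 ≤ v ⬝ᵥ S *ᵥ v := by
  simpa using hS.dotProduct_mulVec_nonneg v

/-- Young's inequality for the form S: expand it at εv - w, where it is nonnegative, and divide by
ε. -/
theorem Matrix.PosSemidef.quadratic_add_le {S : Matrix ι ι ℝ} (hS : S.PosSemidef) {ε : ℝ}
    (hε : 0 < ε) (v w : ι → ℝ) :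
    (v + w) ⬝ᵥ S *ᵥ (v + w) ≤ (1 + ε) * (v ⬝ᵥ S *ᵥ v) + (1 + ε⁻¹) * (w ⬝ᵥ S *ᵥ w) := by
  have h := hS.quadratic_nonneg (ε • v + (-1 : ℝ) • w)
  have h2 := quadratic_combination hS.transpose_eq 1 1 v w
  rw [quadratic_combination hS.transpose_eq] at h
  simp only [one_smul] at h2
  have h3 := mul_nonneg (inv_nonneg.mpr hε.le) h
  have h4 : ε⁻¹ * (ε ^ 2 * (v ⬝ᵥ S *ᵥ v) + 2 * ε * -1 * (v ⬝ᵥ S *ᵥ w) +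
      (-1) ^ 2 * (w ⬝ᵥ S *ᵥ w)) =
      ε * (v ⬝ᵥ S *ᵥ v) - 2 * (v ⬝ᵥ S *ᵥ w) + ε⁻¹ * (w ⬝ᵥ S *ᵥ w) := by
    field_simp; ring
  rw [h2]
  linarith

/-- A positive semidefinite form bounded by `b` satisfies `‖S v‖² ≤ b (vᵀ S v)`. -/
theorem Matrix.PosSemidef.mulVec_dotProduct_self_le {S : Matrix ι ι ℝ} (hS : S.PosSemidef) {b : ℝ}
    (hb : 0 < b) (hSb : ∀ v : ι → ℝ, v ⬝ᵥ S *ᵥ v ≤ b * (v ⬝ᵥ v)) (v : ι → ℝ) :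
    (S *ᵥ v) ⬝ᵥ (S *ᵥ v) ≤ b * (v ⬝ᵥ S *ᵥ v) := by
  -- Testing at bv - Sv gives b² vᵀSv - 2b|Sv|² + (Sv)ᵀS(Sv) ≥ 0, and the last term is at most
  -- b|Sv|².
  have h := hS.quadratic_nonneg (b • v + (-1 : ℝ) • (S *ᵥ v))
  rw [quadratic_combination hS.transpose_eq,
    dotProduct_mulVec_comm_of_isSymm hS.transpose_eq v (S *ᵥ v)] at h
  nlinarith [hSb (S *ᵥ v)]

theorem dotProduct_self_nonneg' (v : ι → ℝ) : 0 ≤ v ⬝ᵥ v :=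
  Finset.sum_nonneg fun i _ => mul_self_nonneg (v i)

theorem sq_le_dotProduct_self (v : ι → ℝ) (i : ι) : v i ^ 2 ≤ v ⬝ᵥ v := by
  rw [sq]
  exact Finset.single_le_sum (f := fun j => v j * v j) (fun j _ => mul_self_nonneg (v j))
    (Finset.mem_univ i)

theorem EuclideanSpace.norm_sq_eq_dotProduct (x : EuclideanSpace ℝ ι) :
    ‖x‖ ^ 2 = x.ofLp ⬝ᵥ x.ofLp := by
  rw [EuclideanSpace.norm_sq_eq, dotProduct]
  exact Finset.sum_congr rfl fun i _ => by rw [Real.norm_eq_abs, sq_abs, sq]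

/-- The Young inequality for the dot product. -/
theorem dotProduct_le_young {c : ℝ} (hc : 0 < c) (v w : ι → ℝ) :
    v ⬝ᵥ w ≤ (v ⬝ᵥ v) / (2 * c) + c / 2 * (w ⬝ᵥ w) := by
  have h := dotProduct_self_nonneg' (v - c • w)
  simp only [sub_dotProduct, dotProduct_sub, smul_dotProduct, dotProduct_smul, smul_eq_mul,
    dotProduct_comm w v] at h
  have h1 : (v ⬝ᵥ v) / (2 * c) + c / 2 * (w ⬝ᵥ w) - v ⬝ᵥ w =
      (v ⬝ᵥ v - c * (v ⬝ᵥ w) - c * (v ⬝ᵥ w - c * (w ⬝ᵥ w))) / (2 * c) := by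
    field_simp; ring
  have h2 := div_nonneg h (by positivity : 0 ≤ 2 * c)
  linarith

variable [DecidableEq ι]

/-- The j-th column is S eⱼ, and |S eⱼ|² ≤ b eⱼᵀS eⱼ ≤ b². This converts bounds on forms into the
entrywise bounds that integrability needs. -/
theorem Matrix.PosSemidef.abs_apply_le {S : Matrix ι ι ℝ} (hS : S.PosSemidef) {b : ℝ}
    (hb : 0 < b) (hSb : ∀ v : ι → ℝ, v ⬝ᵥ S *ᵥ v ≤ b * (v ⬝ᵥ v)) (i j : ι) : |S i j| ≤ b := by
  have h1 := hS.mulVec_dotProduct_self_le hb hSb (Pi.single j 1)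
  have h2 := hSb (Pi.single j 1)
  have h3 := sq_le_dotProduct_self (S *ᵥ Pi.single j 1) i
  simp only [dotProduct_single_one, Pi.single_eq_same, mul_one] at h2
  have h4 : (S *ᵥ Pi.single j 1) i = S i j := by simp
  rw [h4] at h3
  refine abs_le_of_sq_le_sq ?_ hb.le
  nlinarith

theorem dotProduct_mulVec_le_opNorm (S : Matrix ι ι ℝ) (v : ι → ℝ) :
    v ⬝ᵥ S *ᵥ v ≤ opNorm S * (v ⬝ᵥ v) := by
  have h1 := Matrix.inner_toEuclideanCLM S (WithLp.toLp 2 v) (WithLp.toLp 2 v)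
  have h2 := real_inner_le_norm (WithLp.toLp 2 v)
    (Matrix.toEuclideanCLM (𝕜 := ℝ) S (WithLp.toLp 2 v))
  have h3 := (Matrix.toEuclideanCLM (𝕜 := ℝ) S).le_opNorm (WithLp.toLp 2 v)
  have h4 := EuclideanSpace.norm_sq_eq_dotProduct (WithLp.toLp 2 v)
  have h5 := norm_nonneg (WithLp.toLp 2 v)
  simp only [] at h1 h4
  rw [← h1, ← h4, opNorm]
  nlinarith

theorem mulVec_dotProduct_self_le_opNorm (S : Matrix ι ι ℝ) (v : ι → ℝ) :
    (S *ᵥ v) ⬝ᵥ (S *ᵥ v) ≤ opNorm S ^ 2 * (v ⬝ᵥ v) := by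
  have h3 := (Matrix.toEuclideanCLM (𝕜 := ℝ) S).le_opNorm (WithLp.toLp 2 v)
  have h4 := EuclideanSpace.norm_sq_eq_dotProduct (WithLp.toLp 2 v)
  have h5 := EuclideanSpace.norm_sq_eq_dotProduct
    (Matrix.toEuclideanCLM (𝕜 := ℝ) S (WithLp.toLp 2 v))
  rw [Matrix.toEuclideanCLM_toLp] at h5 h3
  simp only [] at h4 h5
  rw [← h4, ← h5, opNorm, ← mul_pow]
  exact pow_le_pow_left₀ (norm_nonneg _) h3 2

theorem Matrix.PosDef.exists_le_quadratic {S : Matrix ι ι ℝ} (hS : S.PosDef) :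
    ∃ c, 0 < c ∧ ∀ v : ι → ℝ, c * (v ⬝ᵥ v) ≤ v ⬝ᵥ S *ᵥ v := by
  -- Testing S at bv - S⁻¹v yields b vᵀSv ≥ |v|² once b dominates the norm of S⁻¹; the added 1 keeps
  -- b positive in dimension zero.
  have hdet : IsUnit S.det := (Matrix.isUnit_iff_isUnit_det _).mp hS.isUnit
  set b := opNorm S⁻¹ + 1 with hb_def
  have hb : 0 < b := by
    have := norm_nonneg (Matrix.toEuclideanCLM (𝕜 := ℝ) S⁻¹)
    rw [hb_def, opNorm]; linarith
  refine ⟨b⁻¹, inv_pos.mpr hb, fun v => ?_⟩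
  have h := hS.posSemidef.quadratic_nonneg (b • v + (-1 : ℝ) • (S⁻¹ *ᵥ v))
  rw [quadratic_combination hS.posSemidef.transpose_eq, Matrix.mulVec_mulVec,
    Matrix.mul_nonsing_inv _ hdet, Matrix.one_mulVec, dotProduct_comm (S⁻¹ *ᵥ v) v] at h
  have h1 := dotProduct_mulVec_le_opNorm S⁻¹ v
  have h2 := dotProduct_self_nonneg' v
  rw [inv_mul_le_iff₀ hb]
  nlinarith

end QuadraticForms

/-! ### Gradient systems: energy, displacement, observability. -/

section GradientSystem

variable {ι : Type} [Fintype ι]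

/-- The data of a gradient-type system `y' = -B Q(t) y`: a positive definite gain `B` and a
measurable positive semidefinite matrix function `Q`, bounded by `b`. -/
structure IsGradientSystem (B : Matrix ι ι ℝ) (Q : ℝ → Matrix ι ι ℝ) (b : ℝ) : Prop where
  posDef : B.PosDef
  measurable : ∀ i j, Measurable fun t => Q t i j
  posSemidef : ∀ t, (Q t).PosSemidef
  bound_pos : 0 < b
  quadratic_le : ∀ t (v : ι → ℝ), v ⬝ᵥ Q t *ᵥ v ≤ b * (v ⬝ᵥ v)

variable {B : Matrix ι ι ℝ} {Q : ℝ → Matrix ι ι ℝ} {b : ℝ}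

theorem IsGradientSystem.measurable_rate (h : IsGradientSystem B Q b) (i j : ι) :
    Measurable fun t => (-(B * Q t)) i j := by
  simp only [Matrix.neg_apply, Matrix.mul_apply]
  exact (Finset.measurable_fun_sum _ fun k _ => (h.measurable k j).const_mul _).neg

theorem IsGradientSystem.rate_mulVec (B : Matrix ι ι ℝ) (Q : ℝ → Matrix ι ι ℝ) (t : ℝ)
    (v : ι → ℝ) : -(B * Q t) *ᵥ v = -(B *ᵥ (Q t *ᵥ v)) := by
  rw [Matrix.neg_mulVec, Matrix.mulVec_mulVec]

variable [DecidableEq ι]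

theorem IsGradientSystem.exists_rate_bound (h : IsGradientSystem B Q b) :
    ∃ K, ∀ t i j, |(-(B * Q t)) i j| ≤ K := by
  obtain ⟨c, hc⟩ := (Set.finite_range fun p : ι × ι => |B p.1 p.2|).bddAbove
  refine ⟨Fintype.card ι * c * b, fun t i j => ?_⟩
  rw [Matrix.neg_apply, abs_neg, mul_apply_eq_mulVec]
  exact abs_mulVec_le (fun i j => hc ⟨(i, j), rfl⟩)
    (fun l => (h.posSemidef t).abs_apply_le h.bound_pos (h.quadratic_le t) l j) i

variable {y : ℝ → ι → ℝ}

theorem IsGradientSystem.intervalIntegrable_quadratic (h : IsGradientSystem B Q b)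
    {y : ℝ → ι → ℝ} (hy : ∀ i, Continuous fun s => y s i) (a c : ℝ) :
    IntervalIntegrable (fun p => y p ⬝ᵥ Q p *ᵥ y p) volume a c := by
  have := IntervalIntegrable.sum (μ := volume) (a := a) (b := c) Finset.univ
    (f := fun i p => y p i * (Q p *ᵥ y p) i) fun i _ =>
      (intervalIntegrable_mulVec h.measurable
        (fun t i j => (h.posSemidef t).abs_apply_le h.bound_pos (h.quadratic_le t) i j)
        hy i a c).continuousOn_mul (hy i).continuousOn
  exact this.congr fun p _ => by simp [dotProduct]

theorem IsGradientSystem.integral_quadratic_mono (h : IsGradientSystem B Q b)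
    (hy : ∀ i, Continuous fun s => y s i) {a c d e : ℝ} (hac : a ≤ c) (hcd : c ≤ d)
    (hde : d ≤ e) :
    ∫ p in c..d, y p ⬝ᵥ Q p *ᵥ y p ≤ ∫ p in a..e, y p ⬝ᵥ Q p *ᵥ y p :=
  intervalIntegral.integral_mono_interval hac hcd hde
    (Eventually.of_forall fun p => (h.posSemidef p).quadratic_nonneg _)
    (h.intervalIntegrable_quadratic hy a e)

/-- The energy identity for `yᵀ B⁻¹ y`. -/
theorem IsGradientSystem.energy_sub (h : IsGradientSystem B Q b)
    (hy : IsTrajectory (fun t => -(B * Q t)) y) (a c : ℝ) :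
    y c ⬝ᵥ B⁻¹ *ᵥ y c - y a ⬝ᵥ B⁻¹ *ᵥ y a = -2 * ∫ p in a..c, y p ⬝ᵥ Q p *ᵥ y p := by
  obtain ⟨K, hK⟩ := h.exists_rate_bound
  have hii := intervalIntegrable_mulVec h.measurable_rate hK hy.continuous
  set z : ℝ → ι → ℝ := fun p => -(B * Q p) *ᵥ y p with hz
  -- The product rule is applied to each pair of coordinates; summing against B⁻¹ then cancels the
  -- gain B in the rate.
  have hprod : ∀ i j, y c i * y c j - y a i * y a j =
      ∫ p in a..c, (z p i * y p j + y p i * z p j) := fun i j =>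
    mul_sub_mul_eq_integral (f := fun s => y s i) (g := fun s => y s j) (hii i a c) (hii j a c)
      (fun s => hy.eq_add_integral a s i) (fun s => hy.eq_add_integral a s j)
  have hint : ∀ i j, IntervalIntegrable (fun p => z p i * y p j + y p i * z p j) volume a c :=
    fun i j => ((hii i a c).mul_continuousOn (hy.continuous j).continuousOn).add
      ((hii j a c).continuousOn_mul (hy.continuous i).continuousOn)
  have hexp : ∀ v w : ι → ℝ, v ⬝ᵥ B⁻¹ *ᵥ w = ∑ i, ∑ j, B⁻¹ i j * (v i * w j) := fun v w => by
    simp only [dotProduct, Matrix.mulVec, Finset.mul_sum]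
    exact Finset.sum_congr rfl fun i _ => Finset.sum_congr rfl fun j _ => by ring
  have hdet : IsUnit B.det := (Matrix.isUnit_iff_isUnit_det _).mp h.posDef.isUnit
  have hsymm : (B⁻¹)ᵀ = B⁻¹ := h.posDef.inv.posSemidef.transpose_eq
  have hpt : ∀ p, ∑ i, ∑ j, B⁻¹ i j * (z p i * y p j + y p i * z p j) =
      -2 * (y p ⬝ᵥ Q p *ᵥ y p) := by
    intro p
    simp only [mul_add, Finset.sum_add_distrib, ← hexp]
    rw [dotProduct_mulVec_comm_of_isSymm hsymm (z p), hz]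
    simp only [IsGradientSystem.rate_mulVec, Matrix.mulVec_neg, Matrix.mulVec_mulVec,
      ← Matrix.mul_assoc, Matrix.nonsing_inv_mul _ hdet, Matrix.one_mul, dotProduct_neg]
    ring
  rw [hexp, hexp, ← Finset.sum_sub_distrib, ← intervalIntegral.integral_const_mul]
  simp only [← hpt]
  rw [intervalIntegral.integral_finsetSum fun i _ =>
    (IntervalIntegrable.sum (μ := volume) Finset.univ
      fun j _ => (hint i j).const_mul (B⁻¹ i j)).congr fun p _ => by simp]
  refine Finset.sum_congr rfl fun i _ => ?_
  rw [intervalIntegral.integral_finsetSum fun j _ => (hint i j).const_mul _,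
    ← Finset.sum_sub_distrib]
  refine Finset.sum_congr rfl fun j _ => ?_
  rw [intervalIntegral.integral_const_mul, ← hprod]
  ring

/-- The displacement of a trajectory is controlled by the dissipated energy. -/
theorem IsGradientSystem.displacement_le (h : IsGradientSystem B Q b)
    (hy : IsTrajectory (fun t => -(B * Q t)) y) {s t : ℝ} (hst : s ≤ t) :
    (y t - y s) ⬝ᵥ (y t - y s) ≤
      (t - s) * (opNorm B ^ 2 * b * ∫ p in s..t, y p ⬝ᵥ Q p *ᵥ y p) := by
  obtain rfl | hlt := hst.eq_or_lt
  · simp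
  obtain ⟨K, hK⟩ := h.exists_rate_bound
  have hii := intervalIntegrable_mulVec h.measurable_rate hK hy.continuous
  set d := y t - y s with hd
  have hc : 0 < t - s := sub_pos.mpr hlt
  -- Young's inequality with weight t - s: after integration its first term is |d|²/2, which is
  -- absorbed by |d|² = ∫ d · y'.
  have hle : ∀ p, d ⬝ᵥ (-(B * Q p) *ᵥ y p) ≤
      (d ⬝ᵥ d) / (2 * (t - s)) + (t - s) / 2 * (opNorm B ^ 2 * b) * (y p ⬝ᵥ Q p *ᵥ y p) := by
    intro p
    refine (dotProduct_le_young hc _ _).trans ?_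
    rw [IsGradientSystem.rate_mulVec, neg_dotProduct_neg, mul_assoc, mul_assoc]
    gcongr
    refine (mulVec_dotProduct_self_le_opNorm B _).trans ?_
    gcongr
    exact (h.posSemidef p).mulVec_dotProduct_self_le h.bound_pos (h.quadratic_le p) _
  have hdd : d ⬝ᵥ d = ∫ p in s..t, d ⬝ᵥ (-(B * Q p) *ᵥ y p) := by
    simp only [dotProduct]
    rw [intervalIntegral.integral_finsetSum fun i _ => (hii i s t).const_mul _]
    refine Finset.sum_congr rfl fun i _ => ?_
    rw [intervalIntegral.integral_const_mul]
    congr 1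
    rw [hd, Pi.sub_apply, hy.eq_add_integral s t i]
    ring
  have hI1 : IntervalIntegrable (fun p => d ⬝ᵥ (-(B * Q p) *ᵥ y p)) volume s t :=
    (IntervalIntegrable.sum (μ := volume) Finset.univ
      fun i _ => (hii i s t).const_mul (d i)).congr fun p _ => by simp [dotProduct]
  have hI2 := h.intervalIntegrable_quadratic hy.continuous s t
  have hmono := intervalIntegral.integral_mono_on hst hI1
    (intervalIntegrable_const.add (hI2.const_mul _)) fun p _ => hle p
  rw [← hdd, intervalIntegral.integral_add intervalIntegrable_const (hI2.const_mul _),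
    intervalIntegral.integral_const, intervalIntegral.integral_const_mul, smul_eq_mul] at hmono
  have h3 : (t - s) * ((d ⬝ᵥ d) / (2 * (t - s))) = (d ⬝ᵥ d) / 2 := by field_simp
  rw [h3] at hmono
  linarith

/-- Excitation of the constant direction `y t` implies observability along the trajectory. -/
theorem IsGradientSystem.observability (h : IsGradientSystem B Q b)
    (hy : IsTrajectory (fun t => -(B * Q t)) y) (hB : 0 < opNorm B) {T t l : ℝ} (hT : 0 < T)
    (hl : l * (y t ⬝ᵥ y t) ≤ ∫ s in (t - T)..t, y t ⬝ᵥ Q s *ᵥ y t) :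
    l * (y t ⬝ᵥ y t) ≤ (1 + opNorm B * (T * b) / Real.sqrt 2) ^ 2 *
      ∫ s in (t - T)..t, y s ⬝ᵥ Q s *ᵥ y s := by
  set m := ∫ s in (t - T)..t, y s ⬝ᵥ Q s *ᵥ y s with hm
  -- With u = Tb this is ε = √φ₁, the minimiser of (1 + ε) + (1 + 1/ε)φ₁; the minimum is (1 + √φ₁)².
  set ε := opNorm B * (T * b) / Real.sqrt 2 with hε_def
  have hb := h.bound_pos
  have hε : 0 < ε := by positivity
  have hε2 : ε ^ 2 = opNorm B ^ 2 * (T * b) ^ 2 / 2 := by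
    rw [hε_def, div_pow, Real.sq_sqrt (by norm_num)]; ring
  have hpt : ∀ s ∈ Icc (t - T) t, y t ⬝ᵥ Q s *ᵥ y t ≤
      (1 + ε) * (y s ⬝ᵥ Q s *ᵥ y s) + (1 + ε⁻¹) * (b * (opNorm B ^ 2 * b * m)) * (t - s) := by
    intro s hs
    have h1 := (h.posSemidef s).quadratic_add_le hε (y s) (y t - y s)
    rw [add_sub_cancel] at h1
    refine h1.trans ?_
    rw [mul_assoc (1 + ε⁻¹)]
    gcongr
    refine (h.quadratic_le s _).trans ?_
    rw [mul_assoc b]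
    gcongr
    refine (h.displacement_le hy hs.2).trans ?_
    rw [mul_comm]
    gcongr
    · linarith [hs.2]
    -- The dissipation on [s, t] is bounded by that on the whole window, so the error is linear in t
    -- - s and integrates to T²/2.
    · exact h.integral_quadratic_mono hy.continuous hs.1 hs.2 le_rfl
  have hI0 : IntervalIntegrable (fun s => y t ⬝ᵥ Q s *ᵥ y t) volume (t - T) t :=
    h.intervalIntegrable_quadratic (y := fun _ => y t) (fun _ => continuous_const) _ _
  have hI1 := h.intervalIntegrable_quadratic hy.continuous (t - T) t
  have hI2 : IntervalIntegrable (fun s => t - s) volume (t - T) t :=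
    Continuous.intervalIntegrable (by fun_prop) _ _
  have hmono := intervalIntegral.integral_mono_on (by linarith) hI0
    ((hI1.const_mul _).add (hI2.const_mul _)) hpt
  have hramp : ∫ s in (t - T)..t, (t - s) = T ^ 2 / 2 := by
    rw [intervalIntegral.integral_comp_sub_left (fun s => s) t]
    simp
  rw [intervalIntegral.integral_add (hI1.const_mul _) (hI2.const_mul _),
    intervalIntegral.integral_const_mul, intervalIntegral.integral_const_mul, hramp] at hmono
  refine hl.trans (hmono.trans_eq ?_)
  have h5 : b * (opNorm B ^ 2 * b * m) * (T ^ 2 / 2) = ε ^ 2 * m := by rw [hε2]; ring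
  rw [mul_assoc (1 + ε⁻¹), h5]
  field_simp
  ring

end GradientSystem

/-! ### The explicit constants. -/

section Constants

theorem iotaThreeLower_pos {u l r : ℝ} (hu : 0 < u) (hl : 0 < l) : 0 < iotaThreeLower u l r := by
  unfold iotaThreeLower
  split_ifs with h
  · positivity
  · refine sq_pos_of_ne_zero (div_ne_zero (fun h0 => ?_) (sub_ne_zero.mpr h))
    -- A zero numerator would give u - l + φ₁l = u, that is φ₁ = 1.
    have h1 := sub_eq_zero.mp h0
    have h2 : 0 < u - l + r ^ 2 * u ^ 2 / 2 * l :=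
      Real.sqrt_pos.mp (h1 ▸ Real.sqrt_pos.mpr hu)
    rw [Real.sqrt_inj h2.le hu.le] at h1
    exact h (mul_right_cancel₀ hl.ne' (by linarith))

/-- Put s = √φ₁, U = √u, W = √l and X = √(u - l + s²l), so X² - U² = (s² - 1)W². Since W ≤ U, this
forces |X - U| ≤ |s - 1|W, because (U + (s - 1)W)² - X² = 2(s - 1)W(U - W). Dividing by |s² - 1|
gives √ι̲₃ ≤ W/(1 + s). -/
theorem iotaThreeLower_mul_le {u l r : ℝ} (hr : 0 ≤ r) (hl : 0 < l) (hlu : l ≤ u) :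
    iotaThreeLower u l r * (1 + r * u / Real.sqrt 2) ^ 2 ≤ l := by
  have hu : 0 < u := hl.trans_le hlu
  set s := r * u / Real.sqrt 2 with hs_def
  have hs : 0 ≤ s := by positivity
  have hs2 : r ^ 2 * u ^ 2 / 2 = s ^ 2 := by
    rw [hs_def, div_pow, Real.sq_sqrt (by norm_num)]; ring
  unfold iotaThreeLower
  rw [hs2]
  split_ifs with h
  · have : s = 1 := by nlinarith
    rw [this, div_mul_eq_mul_div, div_le_iff₀ (by positivity)]
    nlinarith
  · have hs1 : s ≠ 1 := fun h1 => h (by rw [h1]; norm_num)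
    have hX : 0 ≤ u - l + s ^ 2 * l := by nlinarith [sq_nonneg s]
    set X := Real.sqrt (u - l + s ^ 2 * l)
    set U := Real.sqrt u
    set W := Real.sqrt l
    have hX2 : X ^ 2 = u - l + s ^ 2 * l := Real.sq_sqrt hX
    have hU2 : U ^ 2 = u := Real.sq_sqrt hu.le
    have hW2 : W ^ 2 = l := Real.sq_sqrt hl.le
    have hX0 : 0 ≤ X := Real.sqrt_nonneg _
    have hU0 : 0 ≤ U := Real.sqrt_nonneg _
    have hW0 : 0 ≤ W := Real.sqrt_nonneg _
    have hWU : W ≤ U := Real.sqrt_le_sqrt hlu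
    have key : (X - U) ^ 2 ≤ ((s - 1) * W) ^ 2 := by
      rcases le_total 1 s with h1 | h1
      · have hUX : U ≤ X := Real.sqrt_le_sqrt (by
          nlinarith [mul_nonneg (mul_nonneg (sub_nonneg.mpr h1) hl.le)
            (by linarith : 0 ≤ 1 + s)])
        have : X ≤ U + (s - 1) * W := by
          refine abs_le_of_sq_le_sq' ?_ (by nlinarith) |>.2
          nlinarith [mul_nonneg (mul_nonneg (sub_nonneg.mpr h1) hW0) (sub_nonneg.mpr hWU)]
        exact pow_le_pow_left₀ (sub_nonneg.mpr hUX) (by linarith) 2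
      · have hUX : X ≤ U := Real.sqrt_le_sqrt (by
          nlinarith [mul_nonneg (mul_nonneg (sub_nonneg.mpr h1) hl.le)
            (by linarith : 0 ≤ 1 + s)])
        have : U - (1 - s) * W ≤ X := by
          refine abs_le_of_sq_le_sq' ?_ hX0 |>.2
          nlinarith [mul_nonneg (mul_nonneg (sub_nonneg.mpr h1) hW0) (sub_nonneg.mpr hWU)]
        have h3 : (U - X) ^ 2 ≤ ((1 - s) * W) ^ 2 :=
          pow_le_pow_left₀ (sub_nonneg.mpr hUX) (by linarith) 2
        nlinarith
    have hne : (s - 1) ^ 2 ≠ 0 := pow_ne_zero _ (sub_ne_zero.mpr hs1)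
    have hpos : 0 < (s - 1) ^ 2 := lt_of_le_of_ne (sq_nonneg _) hne.symm
    have heq : ((X - U) / (s ^ 2 - 1)) ^ 2 * (1 + s) ^ 2 = (X - U) ^ 2 / (s - 1) ^ 2 := by
      have h2 : s ^ 2 - 1 ≠ 0 := sub_ne_zero.mpr h
      rw [div_pow, div_mul_eq_mul_div, div_eq_div_iff (pow_ne_zero _ h2) hne]
      ring
    rw [heq, div_le_iff₀ hpos, ← hW2]
    linarith [mul_pow (s - 1) W 2]

variable {n : ℕ} {T α ι₁ r₂ lam : ℝ}

theorem iotaTwoLower_le (hα : 0 < α) (hlam : 0 < lam) {ρ : ℝ} (hρ : ρ ∈ Icc (0 : ℝ) 1) :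
    iotaTwoLower n T α ι₁ r₂ lam ≤ max (α * lam * (1 - ρ ^ 2))
      (ι₁ / n * ρ ^ 2 - 2 * r₂ * T * Real.sqrt (ρ ^ 2 * (1 - ρ ^ 2))) := by
  refine csInf_le ⟨0, ?_⟩ (mem_image_of_mem _ hρ)
  rintro _ ⟨ρ, hρ, rfl⟩
  refine le_max_of_le_left (mul_nonneg (by positivity) ?_)
  nlinarith [hρ.1, hρ.2]

/-- By compactness the infimum is attained at some ρ. If ρ < 1 the first entry of the maximum is
positive; at ρ = 1 the square root vanishes and the second is ι₁/n. -/
theorem iotaTwoLower_pos (hn : 0 < n) (hα : 0 < α) (hlam : 0 < lam) (hι₁ : 0 < ι₁) :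
    0 < iotaTwoLower n T α ι₁ r₂ lam := by
  have hcont : Continuous fun ρ : ℝ => max (α * lam * (1 - ρ ^ 2))
      (ι₁ / n * ρ ^ 2 - 2 * r₂ * T * Real.sqrt (ρ ^ 2 * (1 - ρ ^ 2))) := by fun_prop
  obtain ⟨ρ, hρ, hval⟩ := (isCompact_Icc.image hcont).sInf_mem
    ((nonempty_Icc.mpr zero_le_one).image _)
  rw [iotaTwoLower, ← hval]
  rcases hρ.2.lt_or_eq with h | h
  · exact lt_max_of_lt_left (mul_pos (by positivity) (by nlinarith [hρ.1]))
  · refine lt_max_of_lt_right ?_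
    have : (0 : ℝ) < n := by exact_mod_cast hn
    simp only [h]
    norm_num
    positivity

/-- The homogeneous form of the minimum: both bounds have degree one in (p, q), so one normalises by
p + q and takes ρ² = p/(p + q). -/
theorem iotaTwoLower_mul_le (hα : 0 < α) (hlam : 0 < lam) {p q I : ℝ} (hp : 0 ≤ p) (hq : 0 ≤ q)
    (h1 : α * lam * q ≤ I) (h2 : ι₁ / n * p - 2 * r₂ * T * Real.sqrt (p * q) ≤ I) :
    iotaTwoLower n T α ι₁ r₂ lam * (p + q) ≤ I := by
  rcases (add_nonneg hp hq).eq_or_lt with h0 | h0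
  · have hq0 : q = 0 := by linarith
    rw [← h0, mul_zero]
    simpa [hq0] using h1
  set ρ := Real.sqrt (p / (p + q)) with hρ_def
  have hρ2 : ρ ^ 2 = p / (p + q) := Real.sq_sqrt (by positivity)
  have hρ1 : 1 - ρ ^ 2 = q / (p + q) := by rw [hρ2]; field_simp; ring
  have hρ : ρ ∈ Icc (0 : ℝ) 1 :=
    ⟨Real.sqrt_nonneg _, Real.sqrt_le_one.mpr ((div_le_one h0).mpr (by linarith))⟩
  have h := iotaTwoLower_le (n := n) (T := T) (ι₁ := ι₁) (r₂ := r₂) hα hlam hρ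
  have hsq : Real.sqrt (ρ ^ 2 * (1 - ρ ^ 2)) = Real.sqrt (p * q) / (p + q) := by
    rw [hρ1, hρ2, div_mul_div_comm, ← sq, Real.sqrt_div' _ (sq_nonneg _), Real.sqrt_sq h0.le]
  rw [hsq, hρ1, hρ2] at h
  refine (mul_le_mul_of_nonneg_right h h0.le).trans ?_
  rw [max_mul_of_nonneg _ _ h0.le]
  refine max_le (le_of_eq_of_le ?_ h1) (le_of_eq_of_le ?_ h2) <;> field_simp

end Constants

/-! ### Block diagonal and Kronecker structure. -/

section BlockStructure

theorem blockDiag_apply {n p q : ℕ} (M : Fin n → Matrix (Fin p) (Fin q) ℝ) (i : Fin n) (k : Fin p)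
    (j : Fin n) (l : Fin q) : blockDiag M (i, k) (j, l) = if i = j then M i k l else 0 := by
  simp [blockDiag, Matrix.blockDiagonal_apply]

theorem dotProduct_blockDiag_mulVec {n p : ℕ} (M : Fin n → Matrix (Fin p) (Fin p) ℝ)
    (v : Fin n × Fin p → ℝ) :
    v ⬝ᵥ blockDiag M *ᵥ v = ∑ i, (fun k => v (i, k)) ⬝ᵥ M i *ᵥ fun k => v (i, k) := by
  simp only [dotProduct, Matrix.mulVec, Fintype.sum_prod_type, blockDiag_apply, ite_mul, zero_mul]
  refine Finset.sum_congr rfl fun i _ => Finset.sum_congr rfl fun k _ => ?_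
  congr 1
  rw [Finset.sum_comm]
  simp

theorem dotProduct_self_prod {n p : ℕ} (v : Fin n × Fin p → ℝ) :
    v ⬝ᵥ v = ∑ i, (fun k => v (i, k)) ⬝ᵥ fun k => v (i, k) := by
  simp only [dotProduct, Fintype.sum_prod_type]

theorem dotProduct_self_prod_right {n p : ℕ} (v : Fin n × Fin p → ℝ) :
    v ⬝ᵥ v = ∑ k, (fun i => v (i, k)) ⬝ᵥ fun i => v (i, k) := by
  simp only [dotProduct, Fintype.sum_prod_type_right]

theorem blockDiag_posDef {n p : ℕ} {M : Fin n → Matrix (Fin p) (Fin p) ℝ}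
    (hM : ∀ i, (M i).PosDef) : (blockDiag M).PosDef := by
  refine Matrix.PosDef.of_dotProduct_mulVec_pos ?_ fun v hv => ?_
  · ext ⟨i, k⟩ ⟨j, l⟩
    simp only [Matrix.conjTranspose_apply, blockDiag_apply, star_trivial]
    by_cases h : i = j
    · subst h
      simpa using (hM i).isHermitian.apply k l
    · simp [h, Ne.symm h]
  · rw [star_trivial, dotProduct_blockDiag_mulVec]
    obtain ⟨⟨i, k⟩, hik⟩ := Function.ne_iff.mp hv
    refine Finset.sum_pos' (fun i _ => (hM i).posSemidef.quadratic_nonneg _)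
      ⟨i, Finset.mem_univ i, ?_⟩
    have hne : (fun k => v (i, k)) ≠ 0 := fun h => hik (congrFun h k)
    simpa using (hM i).dotProduct_mulVec_pos hne

theorem dotProduct_kronecker_one_mulVec {n p : ℕ} (S : Matrix (Fin n) (Fin n) ℝ)
    (v : Fin n × Fin p → ℝ) :
    v ⬝ᵥ (S ⊗ₖ (1 : Matrix (Fin p) (Fin p) ℝ)) *ᵥ v =
      ∑ k, (fun i => v (i, k)) ⬝ᵥ S *ᵥ fun i => v (i, k) := by
  simp only [dotProduct, Matrix.mulVec, Fintype.sum_prod_type_right, Matrix.kroneckerMap_apply,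
    Matrix.one_apply, mul_ite, mul_one, mul_zero, ite_mul, zero_mul]
  refine Finset.sum_congr rfl fun k _ => Finset.sum_congr rfl fun i _ => ?_
  congr 1
  rw [Finset.sum_comm]
  simp

theorem blockDiag_transpose_mul {n p q : ℕ} (M : Fin n → Matrix (Fin p) (Fin q) ℝ) :
    (blockDiag M)ᵀ * blockDiag M = blockDiag fun i => (M i)ᵀ * M i := by
  rw [blockDiag, blockDiag, Matrix.transpose_submatrix,
    ← Matrix.submatrix_mul _ _ _ _ _ Prod.swap_bijective, Matrix.blockDiagonal_transpose,
    ← Matrix.blockDiagonal_mul]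

/-- In this form the edge set, an index type that varies with time, enters only through the
Laplacian. -/
theorem outputGram_eq {n Ny N : ℕ} {α : ℝ} (hα : 0 ≤ α) (C : Fin n → Matrix (Fin Ny) (Fin N) ℝ)
    {G : SimpleGraph (Fin n)} (o : EdgeOrientation G) :
    outputGram α C o = blockDiag (fun i => (C i)ᵀ * C i) +
      α • (laplacian o ⊗ₖ (1 : Matrix (Fin N) (Fin N) ℝ)) := by
  classical
  rw [outputGram, outputMatrix, Matrix.transpose_fromRows, Matrix.fromCols_mul_fromRows,
    blockDiag_transpose_mul, Matrix.transpose_smul, Matrix.smul_mul, Matrix.mul_smul, smul_smul,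
    Real.mul_self_sqrt hα, ← Matrix.kroneckerMap_transpose, ← Matrix.mul_kronecker_mul]
  simp [laplacian]

end BlockStructure

/-! ### The graph Laplacian. -/

section Laplacian

variable {n : ℕ} {G : SimpleGraph (Fin n)} (o : EdgeOrientation G)

theorem EdgeOrientation.src_ne_tgt (e : G.edgeSet) : o.src e ≠ o.tgt e := by
  have h : s(o.src e, o.tgt e) ∈ G.edgeSet := by rw [o.spec e]; exact e.2
  exact G.ne_of_adj h

theorem sum_orientedIncidence (e : G.edgeSet) : ∑ i, orientedIncidence o i e = 0 := by
  classical
  have h : ∀ i, orientedIncidence o i e =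
      (if i = o.src e then 1 else 0) - if i = o.tgt e then 1 else 0 := by
    intro i
    have := o.src_ne_tgt e
    simp only [orientedIncidence, Matrix.of_apply]
    split_ifs with h1 h2 <;> simp_all
  simp [h]

theorem orientedIncidence_mul_of_ne {i j : Fin n} (hij : i ≠ j) (e : G.edgeSet) :
    orientedIncidence o i e * orientedIncidence o j e =
      if (e : Sym2 (Fin n)) = s(i, j) then -1 else 0 := by
  classical
  have h1 := o.src_ne_tgt e
  simp only [← o.spec e, Sym2.eq_iff]
  simp only [orientedIncidence, Matrix.of_apply]
  by_cases h2 : i = o.src e <;> by_cases h3 : i = o.tgt e <;> by_cases h4 : j = o.src e <;>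
    by_cases h5 : j = o.tgt e <;> simp_all [eq_comm]

/-- Only an edge joining i and j contributes, and its two entries have opposite signs. Hence the
value is independent of the orientation, which need not be measurable in time. -/
theorem laplacian_apply_of_ne [DecidableRel G.Adj] {i j : Fin n} (hij : i ≠ j) :
    laplacian o i j = if G.Adj i j then -1 else 0 := by
  classical
  simp only [laplacian, Matrix.mul_apply, Matrix.transpose_apply, orientedIncidence_mul_of_ne o hij]
  split_ifs with h
  · rw [Finset.sum_eq_single (⟨s(i, j), h⟩ : G.edgeSet)]
    · simp
    · intro e _ he
      rw [if_neg fun h' => he (Subtype.ext h')]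
    · simp
  · refine Finset.sum_eq_zero fun e _ => if_neg fun h' => h ?_
    have := e.2
    rwa [h'] at this

theorem laplacian_mulVec_one : laplacian o *ᵥ (fun _ => 1) = 0 := by
  classical
  ext i
  simp only [laplacian, Matrix.mulVec, dotProduct, Matrix.mul_apply, Matrix.transpose_apply,
    mul_one, Pi.zero_apply]
  rw [Finset.sum_comm]
  simp [← Finset.mul_sum, sum_orientedIncidence]

theorem laplacian_posSemidef : (laplacian o).PosSemidef := by
  classical
  have := Matrix.posSemidef_self_mul_conjTranspose (orientedIncidence o)
  rwa [Matrix.conjTranspose_eq_transpose_of_trivial] at this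

theorem measurable_laplacian {G : ℝ → SimpleGraph (Fin n)} (o : ∀ t, EdgeOrientation (G t))
    (hG : ∀ i j, MeasurableSet {t | (G t).Adj i j}) (i j : Fin n) :
    Measurable fun t => laplacian (o t) i j := by
  classical
  have hoff : ∀ i j, i ≠ j → Measurable fun t => laplacian (o t) i j := by
    intro i j hij
    simp only [laplacian_apply_of_ne _ hij]
    exact Measurable.ite (hG i j) measurable_const measurable_const
  by_cases hij : i = j
  · subst hij
    -- Zero row sums express the diagonal through the off-diagonal entries.
    have h : ∀ t, laplacian (o t) i i = -∑ j ∈ Finset.univ.erase i, laplacian (o t) i j := by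
      intro t
      have h0 := congrFun (laplacian_mulVec_one (o t)) i
      simp only [Matrix.mulVec, dotProduct, mul_one, Pi.zero_apply] at h0
      rw [← Finset.add_sum_erase _ _ (Finset.mem_univ i)] at h0
      linarith
    simp only [h]
    exact (Finset.measurable_fun_sum _ fun j hj =>
      hoff i j (Finset.ne_of_mem_erase hj).symm).neg
  · exact hoff i j hij

end Laplacian

/-! ### Quadratic forms of integrated matrices. -/

section MatrixIntegral

variable {ι : Type} [Fintype ι] {F : ℝ → Matrix ι ι ℝ} {a b : ℝ}

theorem matrixIntegral_mulVec (hF : ∀ i j, IntervalIntegrable (fun s => F s i j) volume a b)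
    (v : ι → ℝ) (i : ι) : (matrixIntegral F a b *ᵥ v) i = ∫ s in a..b, (F s *ᵥ v) i := by
  simp only [Matrix.mulVec, dotProduct, matrixIntegral, Matrix.of_apply]
  rw [intervalIntegral.integral_finsetSum fun j _ => (hF i j).mul_const _]
  simp only [intervalIntegral.integral_mul_const]

theorem intervalIntegrable_quadratic_of_entries
    (hF : ∀ i j, IntervalIntegrable (fun s => F s i j) volume a b) (v : ι → ℝ) :
    IntervalIntegrable (fun s => v ⬝ᵥ F s *ᵥ v) volume a b := by
  have hi : ∀ i, IntervalIntegrable (fun s => (F s *ᵥ v) i) volume a b := fun i =>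
    (IntervalIntegrable.sum (μ := volume) Finset.univ
      fun j _ => (hF i j).mul_const (v j)).congr fun p _ => by simp [Matrix.mulVec, dotProduct]
  exact (IntervalIntegrable.sum (μ := volume) Finset.univ
      fun i _ => (hi i).const_mul (v i)).congr fun p _ => by simp [dotProduct]

theorem dotProduct_matrixIntegral_mulVec
    (hF : ∀ i j, IntervalIntegrable (fun s => F s i j) volume a b) (v : ι → ℝ) :
    v ⬝ᵥ matrixIntegral F a b *ᵥ v = ∫ s in a..b, v ⬝ᵥ F s *ᵥ v := by
  have hi : ∀ i, IntervalIntegrable (fun s => (F s *ᵥ v) i) volume a b := fun i =>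
    (IntervalIntegrable.sum (μ := volume) Finset.univ
      fun j _ => (hF i j).mul_const (v j)).congr fun p _ => by simp [Matrix.mulVec, dotProduct]
  simp only [dotProduct, matrixIntegral_mulVec hF]
  rw [intervalIntegral.integral_finsetSum fun i _ => (hi i).const_mul _]
  simp only [intervalIntegral.integral_const_mul]

end MatrixIntegral

/-! ### The spectral gap on the complement of the constants. -/

section SpectralGap

theorem abs_dotProduct_mulVec_le {ι : Type} [Fintype ι] [DecidableEq ι] {S : Matrix ι ι ℝ} {r : ℝ}
    (hS : opNorm S ≤ r) (v w : ι → ℝ) :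
    |v ⬝ᵥ S *ᵥ w| ≤ r * (Real.sqrt (v ⬝ᵥ v) * Real.sqrt (w ⬝ᵥ w)) := by
  have hnorm : ∀ u : ι → ℝ, Real.sqrt (u ⬝ᵥ u) = ‖WithLp.toLp 2 u‖ := fun u => by
    rw [← Real.sqrt_sq (norm_nonneg _), EuclideanSpace.norm_sq_eq_dotProduct]
  rw [hnorm, hnorm]
  have h1 := Matrix.inner_toEuclideanCLM S (WithLp.toLp 2 v) (WithLp.toLp 2 w)
  have h2 := abs_real_inner_le_norm (WithLp.toLp 2 v)
    (Matrix.toEuclideanCLM (𝕜 := ℝ) S (WithLp.toLp 2 w))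
  have h3 := (Matrix.toEuclideanCLM (𝕜 := ℝ) S).le_of_opNorm_le hS (WithLp.toLp 2 w)
  rw [h1] at h2
  refine h2.trans ?_
  rw [mul_left_comm]
  gcongr

/-- The spectral gap of a symmetric matrix that annihilates the constants. -/
theorem Matrix.IsHermitian.spectral_gap_le {n : ℕ} {S : Matrix (Fin n) (Fin n) ℝ}
    (hS : S.IsHermitian) (hone : S *ᵥ (fun _ => 1) = 0) {lam : ℝ} (hlam : 0 < lam) {i₀ : Fin n}
    (hgap : ∀ i, i ≠ i₀ → lam ≤ hS.eigenvalues i) {e : Fin n → ℝ} (he : ∑ i, e i = 0) :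
    lam * (e ⬝ᵥ e) ≤ e ⬝ᵥ S *ᵥ e := by
  have hsymm : Sᵀ = S := by
    rwa [Matrix.IsHermitian, Matrix.conjTranspose_eq_transpose_of_trivial] at hS
  set β : Fin n → Fin n → ℝ := fun i => (hS.eigenvectorBasis i).ofLp with hβ
  have hparseval : ∀ v w : Fin n → ℝ, ∑ i, (β i ⬝ᵥ v) * (β i ⬝ᵥ w) = v ⬝ᵥ w := by
    intro v w
    have h := hS.eigenvectorBasis.sum_inner_mul_inner (WithLp.toLp 2 v) (WithLp.toLp 2 w)
    simp only [EuclideanSpace.inner_eq_star_dotProduct, star_trivial] at h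
    rw [dotProduct_comm v w, ← h]
    exact Finset.sum_congr rfl fun i _ => by rw [dotProduct_comm w]
  have heig : ∀ i v, β i ⬝ᵥ S *ᵥ v = hS.eigenvalues i * (β i ⬝ᵥ v) := by
    intro i v
    have h := hS.mulVec_eigenvectorBasis i
    rw [dotProduct_mulVec_comm_of_isSymm hsymm]
    change v ⬝ᵥ S *ᵥ (hS.eigenvectorBasis i).ofLp = _
    rw [h, dotProduct_smul, smul_eq_mul, dotProduct_comm v]
  -- Eigenvectors with nonzero eigenvalue are orthogonal to the constants, so by Parseval the
  -- constants lie along the eigenvector i₀ and e has no component there.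
  have hd : ∀ i, i ≠ i₀ → β i ⬝ᵥ (fun _ => 1) = 0 := by
    intro i hi
    have h := heig i fun _ => 1
    rw [hone, dotProduct_zero] at h
    exact (mul_eq_zero.mp h.symm).resolve_left (hlam.trans_le (hgap i hi)).ne'
  have hcd : (β i₀ ⬝ᵥ fun _ => 1) * (β i₀ ⬝ᵥ e) = 0 := by
    have h := hparseval (fun _ => 1) e
    rw [Finset.sum_eq_single i₀ (fun i _ hi => by rw [hd i hi, zero_mul]) (by simp)] at h
    rw [h]
    simpa [dotProduct] using he
  have hdd : (β i₀ ⬝ᵥ fun _ => 1) ≠ 0 := by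
    intro h0
    have h := hparseval (fun _ => 1) (fun _ => 1)
    rw [Finset.sum_eq_single i₀ (fun i _ hi => by rw [hd i hi, zero_mul]) (by simp), h0] at h
    have hn : n ≠ 0 := (Fin.pos i₀).ne'
    simp [dotProduct] at h
    exact hn (by exact_mod_cast h.symm)
  have hc := (mul_eq_zero.mp hcd).resolve_left hdd
  rw [← hparseval e e, ← hparseval e (S *ᵥ e), Finset.mul_sum]
  refine Finset.sum_le_sum fun i _ => ?_
  rw [heig]
  by_cases hi : i = i₀
  · subst hi; simp [hc]
  · nlinarith [hgap i hi, mul_self_nonneg (β i ⬝ᵥ e)]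

end SpectralGap

/-! ### Excitation of a frozen vector. -/

section PersistentExcitation

theorem dotProduct_outputGram_mulVec {n Ny N : ℕ} {α : ℝ} (hα : 0 ≤ α)
    (C : Fin n → Matrix (Fin Ny) (Fin N) ℝ) {G : SimpleGraph (Fin n)} (o : EdgeOrientation G)
    (v : Fin n × Fin N → ℝ) :
    v ⬝ᵥ outputGram α C o *ᵥ v =
      ∑ i, (fun k => v (i, k)) ⬝ᵥ ((C i)ᵀ * C i) *ᵥ (fun k => v (i, k)) +
      α * ∑ k, (fun i => v (i, k)) ⬝ᵥ laplacian o *ᵥ fun i => v (i, k) := by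
  rw [outputGram_eq hα, Matrix.add_mulVec, dotProduct_add, Matrix.smul_mulVec, dotProduct_smul,
    dotProduct_blockDiag_mulVec, dotProduct_kronecker_one_mulVec, smul_eq_mul]

theorem transpose_mul_self_posSemidef {m p : ℕ} (C : Matrix (Fin m) (Fin p) ℝ) :
    (Cᵀ * C).PosSemidef := by
  have := Matrix.posSemidef_conjTranspose_mul_self C
  rwa [Matrix.conjTranspose_eq_transpose_of_trivial] at this

/-- The terms quadratic in e are dropped as nonnegative. Cauchy–Schwarz, first for each i and then
over i, bounds the cross terms; the factor n counts the copies of a. -/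
theorem sum_quadratic_add_ge {n p : ℕ} {M : Fin n → Matrix (Fin p) (Fin p) ℝ} {r : ℝ}
    (hM : ∀ i, (M i).PosSemidef) (hr : 0 ≤ r) (hMr : ∀ i, opNorm (M i) ≤ r) (a : Fin p → ℝ)
    (e : Fin n → Fin p → ℝ) :
    a ⬝ᵥ (∑ i, M i) *ᵥ a - 2 * r * Real.sqrt (n * (a ⬝ᵥ a) * ∑ i, e i ⬝ᵥ e i) ≤
      ∑ i, (a + e i) ⬝ᵥ M i *ᵥ (a + e i) := by
  have hcross : ∑ i, |a ⬝ᵥ M i *ᵥ e i| ≤ r * Real.sqrt (n * (a ⬝ᵥ a) * ∑ i, e i ⬝ᵥ e i) := by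
    refine (Finset.sum_le_sum fun i _ => abs_dotProduct_mulVec_le (hMr i) a (e i)).trans ?_
    rw [← Finset.mul_sum]
    refine mul_le_mul_of_nonneg_left ?_ hr
    refine (Real.sum_mul_le_sqrt_mul_sqrt _ _ _).trans_eq ?_
    simp only [Real.sq_sqrt (dotProduct_self_nonneg' _)]
    rw [← Real.sqrt_mul (Finset.sum_nonneg fun _ _ => dotProduct_self_nonneg' _)]
    simp
  have hsum : a ⬝ᵥ (∑ i, M i) *ᵥ a = ∑ i, a ⬝ᵥ M i *ᵥ a := by
    rw [Matrix.sum_mulVec, dotProduct_sum]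
  have hpt : ∀ i, a ⬝ᵥ M i *ᵥ a - 2 * |a ⬝ᵥ M i *ᵥ e i| ≤ (a + e i) ⬝ᵥ M i *ᵥ (a + e i) := by
    intro i
    have h := quadratic_combination (hM i).transpose_eq 1 1 a (e i)
    simp only [one_smul] at h
    rw [h]
    linarith [neg_abs_le (a ⬝ᵥ M i *ᵥ e i), (hM i).quadratic_nonneg (e i)]
  have := Finset.sum_le_sum fun i (_ : i ∈ Finset.univ) => hpt i
  rw [Finset.sum_sub_distrib, ← Finset.mul_sum] at this
  rw [hsum]
  linarith

variable {n Ny N : ℕ} {C : ℝ → Fin n → Matrix (Fin Ny) (Fin N) ℝ} {G : ℝ → SimpleGraph (Fin n)}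
  {o : ∀ t, EdgeOrientation (G t)}

theorem measurable_transpose_mul_self (hC : ∀ i k l, Measurable fun t => C t i k l) (i : Fin n)
    (k l : Fin N) : Measurable fun t => ((C t i)ᵀ * C t i) k l := by
  simp only [Matrix.mul_apply, Matrix.transpose_apply]
  exact Finset.measurable_fun_sum _ fun m _ => (hC i m k).mul (hC i m l)

theorem measurable_outputGram (hC : ∀ i k l, Measurable fun t => C t i k l)
    (hG : ∀ i j, MeasurableSet {t | (G t).Adj i j}) {α : ℝ} (hα : 0 ≤ α) (a b : Fin n × Fin N) :
    Measurable fun t => outputGram α (C t) (o t) a b := by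
  obtain ⟨i, k⟩ := a
  obtain ⟨j, l⟩ := b
  simp only [outputGram_eq hα, Matrix.add_apply, Matrix.smul_apply, blockDiag_apply,
    Matrix.kroneckerMap_apply, smul_eq_mul]
  refine Measurable.add ?_ (((measurable_laplacian o hG i j).mul_const _).const_mul _)
  split_ifs
  · exact measurable_transpose_mul_self hC i k l
  · exact measurable_const

theorem outputGram_posSemidef (α : ℝ) (C : Fin n → Matrix (Fin Ny) (Fin N) ℝ)
    {G : SimpleGraph (Fin n)} (o : EdgeOrientation G) : (outputGram α C o).PosSemidef := by
  classical
  have := Matrix.posSemidef_conjTranspose_mul_self (outputMatrix α C o)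
  rwa [Matrix.conjTranspose_eq_transpose_of_trivial] at this

theorem outputGram_quadratic_le {α r₂ r₃ : ℝ} (hα : 0 ≤ α) {C : Fin n → Matrix (Fin Ny) (Fin N) ℝ}
    {G : SimpleGraph (Fin n)} {o : EdgeOrientation G} (hC : ∀ i, opNorm ((C i)ᵀ * C i) ≤ r₂)
    (hL : opNorm (laplacian o) ≤ r₃) (v : Fin n × Fin N → ℝ) :
    v ⬝ᵥ outputGram α C o *ᵥ v ≤ (r₂ + α * r₃) * (v ⬝ᵥ v) := by
  have hquad : ∀ {p : ℕ} {S : Matrix (Fin p) (Fin p) ℝ} {r : ℝ}, opNorm S ≤ r →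
      ∀ w : Fin p → ℝ, w ⬝ᵥ S *ᵥ w ≤ r * (w ⬝ᵥ w) := fun h w =>
    (dotProduct_mulVec_le_opNorm _ w).trans
      (mul_le_mul_of_nonneg_right h (dotProduct_self_nonneg' w))
  rw [dotProduct_outputGram_mulVec hα, add_mul, mul_assoc]
  gcongr
  · rw [dotProduct_self_prod, Finset.mul_sum]
    exact Finset.sum_le_sum fun i _ => hquad (hC i) _
  · rw [dotProduct_self_prod_right, Finset.mul_sum]
    exact Finset.sum_le_sum fun k _ => hquad hL _

/-- Cooperative persistent excitation and connectedness on average make the averaged output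
Gramian positive definite. -/
theorem iotaTwoLower_mul_le_integral_outputGram {α T ι₁ r₂ r₃ lam t : ℝ} (hα : 0 < α) (hT : 0 < T)
    (hC : ∀ i k l, Measurable fun t => C t i k l)
    (hG : ∀ i j, MeasurableSet {t | (G t).Adj i j})
    (hr₂ : 0 < r₂) (hCb : ∀ t, 0 ≤ t → ∀ i, opNorm ((C t i)ᵀ * C t i) ≤ r₂)
    (hr₃ : 0 < r₃) (hLb : ∀ t, 0 ≤ t → opNorm (laplacian (o t)) ≤ r₃)
    (hlam : 0 < lam) (ht : T ≤ t)
    (hPE : (excitation C T t - ι₁ • (1 : Matrix (Fin N) (Fin N) ℝ)).PosSemidef)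
    (hconn : ∃ i₀, ∀ i, i ≠ i₀ → lam ≤ (avgLaplacian_isHermitian G o T t).eigenvalues i)
    (v : Fin n × Fin N → ℝ) :
    iotaTwoLower n T α ι₁ r₂ lam * (v ⬝ᵥ v) ≤
      ∫ s in (t - T)..t, v ⬝ᵥ outputGram α (C s) (o s) *ᵥ v := by
  obtain ⟨i₀, hgap⟩ := hconn
  have hn : (0 : ℝ) < n := by exact_mod_cast Fin.pos i₀
  have hle : t - T ≤ t := by linarith
  have hpos : ∀ s ∈ Icc (t - T) t, 0 ≤ s := fun s hs => by linarith [hs.1]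
  have hpos' : ∀ s ∈ uIoc (t - T) t, 0 ≤ s := fun s hs =>
    hpos s (by rw [uIoc_of_le hle] at hs; exact Ioc_subset_Icc_self hs)
  have hquad : ∀ {p : ℕ} {S : Matrix (Fin p) (Fin p) ℝ} {r : ℝ}, opNorm S ≤ r →
      ∀ w : Fin p → ℝ, w ⬝ᵥ S *ᵥ w ≤ r * (w ⬝ᵥ w) := fun h w =>
    (dotProduct_mulVec_le_opNorm _ w).trans
      (mul_le_mul_of_nonneg_right h (dotProduct_self_nonneg' w))
  have hCI : ∀ i k l, IntervalIntegrable (fun s => ((C s i)ᵀ * C s i) k l) volume (t - T) t :=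
    fun i k l => intervalIntegrable_of_measurable_of_abs_le (measurable_transpose_mul_self hC i k l)
      fun s hs => (transpose_mul_self_posSemidef (C s i)).abs_apply_le hr₂
        (hquad (hCb s (hpos' s hs) i)) k l
  have hLI : ∀ i j, IntervalIntegrable (fun s => laplacian (o s) i j) volume (t - T) t :=
    fun i j => intervalIntegrable_of_measurable_of_abs_le (measurable_laplacian o hG i j)
      fun s hs => (laplacian_posSemidef (o s)).abs_apply_le hr₃ (hquad (hLb s (hpos' s hs))) i j
  -- the consensus component and the disagreement
  set a : Fin N → ℝ := fun k => (∑ i, v (i, k)) / n with ha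
  set e : Fin n → Fin N → ℝ := fun i k => v (i, k) - a k with he
  have he0 : ∀ k, ∑ i, e i k = 0 := fun k => by
    simp only [he, ha, Finset.sum_sub_distrib, Finset.sum_const, Finset.card_univ,
      Fintype.card_fin, nsmul_eq_mul]
    field_simp
    ring
  have hve : ∀ i, (fun k => v (i, k)) = a + e i := fun i => by ext k; simp [he]
  have hvk : ∀ k, (fun i => v (i, k)) = (1 : ℝ) • (fun i => e i k) + a k • fun _ => 1 := fun k => by
    ext i; simp [he]
  set q := ∑ i, e i ⬝ᵥ e i with hq
  have hq' : q = ∑ k, (fun i => e i k) ⬝ᵥ fun i => e i k := by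
    simp only [hq, dotProduct]; exact Finset.sum_comm
  have hvv : v ⬝ᵥ v = n * (a ⬝ᵥ a) + q := by
    have h1 : ∀ i, (a + e i) ⬝ᵥ (a + e i) = a ⬝ᵥ a + 2 * (a ⬝ᵥ e i) + e i ⬝ᵥ e i := fun i => by
      simp only [add_dotProduct, dotProduct_add, dotProduct_comm (e i) a]; ring
    have h2 : ∑ i, a ⬝ᵥ e i = 0 := by
      rw [← dotProduct_sum]
      have : ∑ i, e i = 0 := by ext k; simpa using he0 k
      rw [this, dotProduct_zero]
    simp only [dotProduct_self_prod v, hve, h1, Finset.sum_add_distrib, ← Finset.mul_sum, h2]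
    simp [hq]
  have hIC : ∀ i, IntervalIntegrable (fun s => (fun k => v (i, k)) ⬝ᵥ
      ((C s i)ᵀ * C s i) *ᵥ (fun k => v (i, k))) volume (t - T) t := fun i =>
    intervalIntegrable_quadratic_of_entries (hCI i) _
  have hICs := (IntervalIntegrable.sum (μ := volume) Finset.univ fun i _ => hIC i).congr
    (g := fun s => ∑ i, (fun k => v (i, k)) ⬝ᵥ ((C s i)ᵀ * C s i) *ᵥ (fun k => v (i, k)))
    fun p _ => by simp
  have hIL : ∀ k, IntervalIntegrable (fun s => (fun i => v (i, k)) ⬝ᵥ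
      laplacian (o s) *ᵥ (fun i => v (i, k))) volume (t - T) t := fun k =>
    intervalIntegrable_quadratic_of_entries hLI _
  have hILs := (IntervalIntegrable.sum (μ := volume) Finset.univ fun k _ => hIL k).congr
    (g := fun s => ∑ k, (fun i => v (i, k)) ⬝ᵥ laplacian (o s) *ᵥ (fun i => v (i, k)))
    fun p _ => by simp
  simp only [dotProduct_outputGram_mulVec hα.le]
  rw [intervalIntegral.integral_add hICs (hILs.const_mul α), intervalIntegral.integral_const_mul]
  -- the contribution of the network
  have hL : lam * q ≤
      ∫ s in (t - T)..t, ∑ k, (fun i => v (i, k)) ⬝ᵥ laplacian (o s) *ᵥ (fun i => v (i, k)) := by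
    have hone : avgLaplacian G o T t *ᵥ (fun _ => 1) = 0 := by
      ext i
      rw [avgLaplacian, matrixIntegral_mulVec hLI]
      simp [laplacian_mulVec_one]
    rw [intervalIntegral.integral_finsetSum fun k _ => hIL k, hq', Finset.mul_sum]
    refine Finset.sum_le_sum fun k _ => ?_
    rw [← dotProduct_matrixIntegral_mulVec hLI]
    change _ ≤ _ ⬝ᵥ avgLaplacian G o T t *ᵥ _
    have hH := avgLaplacian_isHermitian G o T t
    have hsymm : (avgLaplacian G o T t)ᵀ = avgLaplacian G o T t := by
      have := hH
      rwa [Matrix.IsHermitian, Matrix.conjTranspose_eq_transpose_of_trivial] at this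
    -- The averaged Laplacian annihilates the consensus part, so only the disagreement survives.
    rw [hvk, quadratic_combination hsymm, hone, dotProduct_zero, dotProduct_zero]
    have := hH.spectral_gap_le hone hlam hgap (he0 k)
    linarith
  -- the contribution of the regressors
  have hC1 : ι₁ / n * (n * (a ⬝ᵥ a)) - 2 * r₂ * T * Real.sqrt (n * (a ⬝ᵥ a) * q) ≤
      ∫ s in (t - T)..t, ∑ i, (fun k => v (i, k)) ⬝ᵥ ((C s i)ᵀ * C s i) *ᵥ
        (fun k => v (i, k)) := by
    have hsumI : ∀ k l, IntervalIntegrable (fun s => (∑ i, (C s i)ᵀ * C s i) k l)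
        volume (t - T) t := fun k l =>
      (IntervalIntegrable.sum (μ := volume) Finset.univ fun i _ => hCI i k l).congr
        fun p _ => by simp [Matrix.sum_apply]
    have hexc : ι₁ * (a ⬝ᵥ a) ≤ ∫ s in (t - T)..t, a ⬝ᵥ (∑ i, (C s i)ᵀ * C s i) *ᵥ a := by
      have h := hPE.quadratic_nonneg a
      rw [Matrix.sub_mulVec, dotProduct_sub, Matrix.smul_mulVec, Matrix.one_mulVec,
        dotProduct_smul, smul_eq_mul, excitation, dotProduct_matrixIntegral_mulVec hsumI] at h
      linarith
    have hI := intervalIntegrable_quadratic_of_entries hsumI a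
    have hmono := intervalIntegral.integral_mono_on hle
      (hI.sub (intervalIntegrable_const
        (c := 2 * r₂ * Real.sqrt (n * (a ⬝ᵥ a) * q)))) hICs fun s hs => by
        simp only [hve]
        exact sum_quadratic_add_ge (fun i => transpose_mul_self_posSemidef (C s i)) hr₂.le
          (hCb s (hpos s hs)) a e
    rw [intervalIntegral.integral_sub hI intervalIntegrable_const,
      intervalIntegral.integral_const, smul_eq_mul] at hmono
    have h3 : ι₁ / n * (n * (a ⬝ᵥ a)) = ι₁ * (a ⬝ᵥ a) := by field_simp
    rw [h3]
    refine le_trans ?_ hmono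
    rw [sub_sub_cancel]
    linarith
  have hC0 : 0 ≤ ∫ s in (t - T)..t, ∑ i, (fun k => v (i, k)) ⬝ᵥ ((C s i)ᵀ * C s i) *ᵥ
        (fun k => v (i, k)) :=
    intervalIntegral.integral_nonneg hle fun s _ => Finset.sum_nonneg fun i _ =>
      (transpose_mul_self_posSemidef (C s i)).quadratic_nonneg _
  have hp0 : 0 ≤ n * (a ⬝ᵥ a) := mul_nonneg hn.le (dotProduct_self_nonneg' a)
  have hq0 : 0 ≤ q := Finset.sum_nonneg fun i _ => dotProduct_self_nonneg' _
  have hαL := mul_le_mul_of_nonneg_left hL hα.le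
  have hαq : 0 ≤ α * (lam * q) := by positivity
  rw [hvv]
  -- Each bound holds for the total because the other contribution is nonnegative.
  refine iotaTwoLower_mul_le hα hlam hp0 hq0 ?_ ?_
  · linarith
  · linarith

end PersistentExcitation

/-! ### Changing the coefficients at negative times. -/

section Transfer

variable {ι : Type} [Fintype ι] [DecidableEq ι]

/-- The Peano–Baker series is the state transition matrix as soon as the coefficient agrees on
`[0, ∞)` with a bounded measurable one. -/
theorem isStateTransition_transitionMatrix {A A' : ℝ → Matrix ι ι ℝ} {K : ℝ}
    (hA : ∀ i j, Measurable fun t => A' t i j) (hK : ∀ t i j, |A' t i j| ≤ K)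
    (hAA : EqOn A A' (Ici 0)) : IsStateTransition A (transitionMatrix A) := by
  intro s t hs ht
  have hsub : uIcc t s ⊆ Ici 0 := Set.ordConnected_Ici.uIcc_subset ht hs
  have heq : ∀ p ∈ uIcc t s,
      A' p * transitionMatrix A' p t = A p * transitionMatrix A p t := fun p hp => by
    rw [hAA (hsub hp), transitionMatrix_congr Set.ordConnected_Ici hAA (hsub hp) ht]
  refine ⟨fun i j => ?_, ?_⟩
  · refine (intervalIntegrable_mulVec hA hK
      (fun l => transitionMatrix_continuous hA hK t l j) i t s).congr fun p hp => ?_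
    change (A' p * transitionMatrix A' p t) i j = _
    rw [heq p (uIoc_subset_uIcc hp)]
  · rw [transitionMatrix_congr Set.ordConnected_Ici hAA hs ht]
    ext i j
    rw [transitionMatrix_eq_add_integral hA hK s t, Matrix.add_apply]
    congr 1
    exact intervalIntegral.integral_congr fun p hp => by simp only [heq p hp]

theorem IsSolution.congr {A A' : ℝ → Matrix ι ι ℝ} (hAA : EqOn A A' (Ici 0)) {t₀ : ℝ}
    (ht₀ : 0 ≤ t₀) {x : ℝ → EuclideanSpace ℝ ι} (hx : IsSolution A t₀ x) :
    IsSolution A' t₀ x := by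
  intro t ht
  obtain ⟨h1, h2⟩ := hx t ht
  have hsub : uIcc t₀ t ⊆ Ici 0 := Set.ordConnected_Ici.uIcc_subset ht₀ (ht₀.trans ht)
  refine ⟨h1.congr fun p hp => by simp only [hAA (hsub (uIoc_subset_uIcc hp))], ?_⟩
  conv_lhs => rw [h2]
  congr 1
  exact intervalIntegral.integral_congr fun p hp => by simp only [hAA (hsub hp)]

end Transfer

/-! ### Stability and Lyapunov bounds for gradient systems. -/

section Lyapunov

variable {ι : Type} [Fintype ι] [DecidableEq ι] {B : Matrix ι ι ℝ} {Q : ℝ → Matrix ι ι ℝ} {b : ℝ}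

/-- The trajectory of a gradient system through `v` at time `t`. -/
theorem IsGradientSystem.isTrajectory (h : IsGradientSystem B Q b) (t : ℝ) (v : ι → ℝ) :
    IsTrajectory (fun t => -(B * Q t))
      (fun s => transitionMatrix (fun t => -(B * Q t)) s t *ᵥ v) := by
  obtain ⟨K, hK⟩ := h.exists_rate_bound
  exact isTrajectory_transitionMatrix h.measurable_rate hK t v

/-- The window [t - T, t] may begin before t₀, so the solution is extended to the whole line; by
uniqueness Φ(s,t)x(t) is then the value of one trajectory at s, for every t. -/
theorem IsGradientSystem.exists_trajectory (h : IsGradientSystem B Q b) {t₀ : ℝ}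
    {x : ℝ → EuclideanSpace ℝ ι} (hx : IsSolution (fun t => -(B * Q t)) t₀ x) :
    ∃ y, IsTrajectory (fun t => -(B * Q t)) y ∧ (∀ t, t₀ ≤ t → y t = (x t).ofLp) ∧
      ∀ t, t₀ ≤ t → ∀ s, transitionMatrix (fun t => -(B * Q t)) s t *ᵥ (x t).ofLp = y s := by
  obtain ⟨K, hK⟩ := h.exists_rate_bound
  have hy := h.isTrajectory t₀ (x t₀).ofLp
  have hyx : ∀ t, t₀ ≤ t →
      transitionMatrix (fun t => -(B * Q t)) t t₀ *ᵥ (x t₀).ofLp = (x t).ofLp := fun t ht =>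
    (hx.eq_transitionMatrix h.measurable_rate hK ht).symm
  refine ⟨_, hy, hyx, fun t ht s => ?_⟩
  refine congrFun ((h.isTrajectory t (x t).ofLp).unique h.measurable_rate hK hy (a := t) ?_) s
  simp only [transitionMatrix_self, Matrix.one_mulVec, hyx t ht]

/-- Quadratic forms of weighted Gramians are weighted integrals along trajectories. -/
theorem IsGradientSystem.quadForm_gramian (h : IsGradientSystem B Q b)
    {A Q' : ℝ → Matrix ι ι ℝ} (hA : EqOn A (fun t => -(B * Q t)) (Ici 0))
    (hQ : EqOn Q' Q (Ici 0)) {c : ℝ → ℝ} (hc : Continuous c) {T t : ℝ} (hT : 0 ≤ T) (ht : T ≤ t)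
    (w : ι → ℝ) :
    w ⬝ᵥ matrixIntegral (fun s => c s • ((transitionMatrix A s t)ᵀ * Q' s *
      transitionMatrix A s t)) (t - T) t *ᵥ w =
    ∫ s in (t - T)..t, c s * ((transitionMatrix (fun t => -(B * Q t)) s t *ᵥ w) ⬝ᵥ
      Q s *ᵥ (transitionMatrix (fun t => -(B * Q t)) s t *ᵥ w)) := by
  obtain ⟨K, hK⟩ := h.exists_rate_bound
  have hsub : uIcc (t - T) t ⊆ Ici 0 :=
    Set.ordConnected_Ici.uIcc_subset (sub_nonneg.mpr ht) (hT.trans ht)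
  set Φ := fun s => transitionMatrix (fun t => -(B * Q t)) s t with hΦ
  have hΦc : ∀ i j, Continuous fun s => Φ s i j := fun i j =>
    transitionMatrix_continuous h.measurable_rate hK t i j
  have heq : ∀ s ∈ uIcc (t - T) t, c s • ((Φ s)ᵀ * Q s * Φ s) =
      c s • ((transitionMatrix A s t)ᵀ * Q' s * transitionMatrix A s t) := fun s hs => by
    rw [hQ (hsub hs), transitionMatrix_congr Set.ordConnected_Ici hA (hsub hs) (hT.trans ht)]
  have hint : ∀ i j, IntervalIntegrable (fun s => (c s • ((transitionMatrix A s t)ᵀ * Q' s *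
      transitionMatrix A s t)) i j) volume (t - T) t := by
    intro i j
    have hcol := intervalIntegrable_mulVec h.measurable
      (fun t i j => (h.posSemidef t).abs_apply_le h.bound_pos (h.quadratic_le t) i j)
      (y := fun s l => Φ s l j) (fun l => hΦc l j)
    have hsum := (IntervalIntegrable.sum (μ := volume) (a := t - T) (b := t) Finset.univ
      fun k _ => (hcol k _ _).continuousOn_mul (hΦc k i).continuousOn).continuousOn_mul
        (hc.continuousOn)
    refine hsum.congr fun s hs => ?_
    rw [← heq s (uIoc_subset_uIcc hs), Matrix.smul_apply, smul_eq_mul, Finset.sum_apply,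
      Matrix.mul_assoc]
    rfl
  rw [dotProduct_matrixIntegral_mulVec hint]
  refine intervalIntegral.integral_congr fun s hs => ?_
  simp only [← heq s hs]
  rw [Matrix.smul_mulVec, dotProduct_smul, smul_eq_mul, Matrix.mul_assoc, ← Matrix.mulVec_mulVec,
    Matrix.dotProduct_mulVec, ← Matrix.mulVec_transpose, Matrix.transpose_transpose,
    ← Matrix.mulVec_mulVec]

/-- Uniform observability of a gradient system implies global uniform asymptotic stability. -/
theorem IsGradientSystem.isGUAS (h : IsGradientSystem B Q b) {A : ℝ → Matrix ι ι ℝ}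
    (hA : EqOn A (fun t => -(B * Q t)) (Ici 0)) {T μ : ℝ} (hT : 0 < T) (hμ : 0 < μ)
    (hobs : ∀ y, IsTrajectory (fun t => -(B * Q t)) y → ∀ t, T ≤ t →
      μ * (y t ⬝ᵥ y t) ≤ ∫ s in (t - T)..t, y s ⬝ᵥ Q s *ᵥ y s) : IsGUAS A := by
  obtain ⟨c₁, hc₁, hlow⟩ := h.posDef.inv.exists_le_quadratic
  obtain ⟨c₂, hc₂, hupp⟩ : ∃ c₂, 0 < c₂ ∧ ∀ v : ι → ℝ, v ⬝ᵥ B⁻¹ *ᵥ v ≤ c₂ * (v ⬝ᵥ v) := by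
    refine ⟨opNorm B⁻¹ + 1, add_pos_of_nonneg_of_pos (norm_nonneg _) one_pos, fun v => ?_⟩
    refine (dotProduct_mulVec_le_opNorm _ v).trans ?_
    have := dotProduct_self_nonneg' v
    nlinarith
  have hmono : ∀ y, IsTrajectory (fun t => -(B * Q t)) y → ∀ s t, s ≤ t →
      y t ⬝ᵥ B⁻¹ *ᵥ y t ≤ y s ⬝ᵥ B⁻¹ *ᵥ y s := by
    intro y hy s t hst
    have h1 := h.energy_sub hy s t
    have h2 : 0 ≤ ∫ p in s..t, y p ⬝ᵥ Q p *ᵥ y p :=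
      intervalIntegral.integral_nonneg hst fun p _ => (h.posSemidef p).quadratic_nonneg _
    linarith
  -- Over one window E(t - T) = E(t) + 2∫g ≥ E(t) + 2μ|y(t)|² ≥ (1 + 2μ/c₂)E(t).
  set γ := (1 + 2 * μ / c₂)⁻¹ with hγ_def
  have hγ0 : 0 < 1 + 2 * μ / c₂ := by positivity
  have hγpos : 0 < γ := inv_pos.mpr hγ0
  have hγ1 : γ < 1 := inv_lt_one_of_one_lt₀ (by linarith [show 0 < 2 * μ / c₂ by positivity])
  have hstep : ∀ y, IsTrajectory (fun t => -(B * Q t)) y → ∀ t, T ≤ t →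
      y t ⬝ᵥ B⁻¹ *ᵥ y t ≤ γ * (y (t - T) ⬝ᵥ B⁻¹ *ᵥ y (t - T)) := by
    intro y hy t ht
    have h1 := h.energy_sub hy (t - T) t
    have h2 := hobs y hy t ht
    have h3 := mul_le_mul_of_nonneg_left (hupp (y t)) (by positivity : 0 ≤ μ / c₂)
    have h4 : μ / c₂ * (c₂ * (y t ⬝ᵥ y t)) = μ * (y t ⬝ᵥ y t) := by field_simp
    rw [hγ_def, ← div_eq_inv_mul, le_div_iff₀ hγ0]
    have h5 : y t ⬝ᵥ B⁻¹ *ᵥ y t * (1 + 2 * μ / c₂) =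
        y t ⬝ᵥ B⁻¹ *ᵥ y t + 2 * (μ / c₂ * (y t ⬝ᵥ B⁻¹ *ᵥ y t)) := by ring
    rw [h5]
    linarith
  have hdecay : ∀ y, IsTrajectory (fun t => -(B * Q t)) y → ∀ t₀, 0 ≤ t₀ → ∀ k : ℕ,
      y (t₀ + k * T) ⬝ᵥ B⁻¹ *ᵥ y (t₀ + k * T) ≤ γ ^ k * (y t₀ ⬝ᵥ B⁻¹ *ᵥ y t₀) := by
    intro y hy t₀ ht₀ k
    induction k with
    | zero => simp
    | succ k ih =>
      have hk : 0 ≤ (k : ℝ) * T := by positivity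
      have h1 := hstep y hy (t₀ + (k + 1 : ℕ) * T) (by push_cast; linarith)
      rw [show t₀ + ((k + 1 : ℕ) : ℝ) * T - T = t₀ + k * T by push_cast; ring] at h1
      refine h1.trans ?_
      rw [pow_succ', mul_assoc]
      gcongr
  refine ⟨⟨fun ε => ε / Real.sqrt (c₂ / c₁), fun ε hε => by positivity, ?_, ?_⟩, ?_⟩
  · exact tendsto_id.atTop_div_const (by positivity)
  · intro ε hε t₀ ht₀ x hx hxε t ht
    obtain ⟨y, hy, hyx, -⟩ := h.exists_trajectory (hx.congr hA ht₀)
    have h1 := hmono y hy t₀ t ht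
    rw [hyx t₀ le_rfl, hyx t ht] at h1
    have h2 := (hlow _).trans (h1.trans (hupp _))
    rw [← EuclideanSpace.norm_sq_eq_dotProduct, ← EuclideanSpace.norm_sq_eq_dotProduct] at h2
    rw [lt_div_iff₀ (by positivity)] at hxε
    have h3 := pow_lt_pow_left₀ hxε (by positivity) two_ne_zero
    rw [mul_pow, Real.sq_sqrt (by positivity)] at h3
    have h4 : ‖x t‖ ^ 2 ≤ ‖x t₀‖ ^ 2 * (c₂ / c₁) := by
      rw [mul_div_assoc', le_div_iff₀ hc₁]; linarith
    exact lt_of_pow_lt_pow_left₀ 2 hε.le (h4.trans_lt h3)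
  · intro η c hη hc
    obtain ⟨k, hk⟩ := exists_pow_lt_of_lt_one (by positivity : 0 < c₁ * η ^ 2 / (c₂ * c ^ 2)) hγ1
    -- The extra T keeps the waiting time positive when k = 0.
    refine ⟨k * T + T, by positivity, fun t₀ ht₀ x hx hxc t ht => ?_⟩
    have hkT : 0 ≤ (k : ℝ) * T := by positivity
    obtain ⟨y, hy, hyx, -⟩ := h.exists_trajectory (hx.congr hA ht₀)
    have h1 := (hmono y hy (t₀ + k * T) t (by linarith)).trans (hdecay y hy t₀ ht₀ k)
    rw [hyx t₀ le_rfl, hyx t (by linarith)] at h1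
    have h2 := (hlow _).trans (h1.trans (mul_le_mul_of_nonneg_left (hupp _) (by positivity)))
    rw [← EuclideanSpace.norm_sq_eq_dotProduct, ← EuclideanSpace.norm_sq_eq_dotProduct] at h2
    rw [lt_div_iff₀ (by positivity)] at hk
    have h3 : γ ^ k * (c₂ * ‖x t₀‖ ^ 2) ≤ γ ^ k * (c₂ * c ^ 2) := by gcongr
    have h4 : c₁ * ‖x t‖ ^ 2 < c₁ * η ^ 2 := h2.trans_lt (h3.trans_lt hk)
    exact lt_of_pow_lt_pow_left₀ 2 hη.le (lt_of_mul_lt_mul_left h4 hc₁.le)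

/-- Quadratic bounds of the Lyapunov function. -/
theorem IsGradientSystem.exists_lyapunov_bounds (h : IsGradientSystem B Q b) {T : ℝ} (hT : 0 < T) :
    ∃ c₁ c₂, 0 < c₁ ∧ 0 < c₂ ∧ ∀ y, IsTrajectory (fun t => -(B * Q t)) y → ∀ t,
      c₁ * (y t ⬝ᵥ y t) ≤ T / 2 * (y t ⬝ᵥ B⁻¹ *ᵥ y t) +
        ∫ s in (t - T)..t, (s - t + T) * (y s ⬝ᵥ Q s *ᵥ y s) ∧
      T / 2 * (y t ⬝ᵥ B⁻¹ *ᵥ y t) +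
        ∫ s in (t - T)..t, (s - t + T) * (y s ⬝ᵥ Q s *ᵥ y s) ≤ c₂ * (y t ⬝ᵥ y t) := by
  obtain ⟨K, hK⟩ := h.exists_rate_bound
  obtain ⟨c₁, hc₁, hlow⟩ := h.posDef.inv.exists_le_quadratic
  set R := (Fintype.card ι * Real.exp (Fintype.card ι * K * T)) ^ 2 with hR
  set c₂ := T / 2 * (opNorm B⁻¹ * (Fintype.card ι * R)) with hc₂
  have hnn : 0 ≤ opNorm B⁻¹ := norm_nonneg _
  have hc₂0 : 0 ≤ c₂ := by positivity
  -- The 1 keeps the upper constant positive in dimension zero.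
  refine ⟨T / 2 * c₁, c₂ + 1, by positivity, by positivity, fun y hy t => ⟨?_, ?_⟩⟩
  · have h1 : 0 ≤ ∫ s in (t - T)..t, (s - t + T) * (y s ⬝ᵥ Q s *ᵥ y s) :=
      intervalIntegral.integral_nonneg (by linarith) fun s hs =>
        mul_nonneg (by linarith [hs.1]) ((h.posSemidef s).quadratic_nonneg _)
    have h2 := mul_le_mul_of_nonneg_left (hlow (y t)) (by positivity : 0 ≤ T / 2)
    linarith
  · have hI := h.intervalIntegrable_quadratic hy.continuous (t - T) t
    -- The ramp is at most T, and T∫g = (T/2)(E(t - T) - E(t)); hence V ≤ (T/2)E(t - T), which the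
    -- backward transition over time T bounds by |y(t)|².
    have h1 : ∫ s in (t - T)..t, (s - t + T) * (y s ⬝ᵥ Q s *ᵥ y s) ≤
        ∫ s in (t - T)..t, T * (y s ⬝ᵥ Q s *ᵥ y s) :=
      intervalIntegral.integral_mono_on (by linarith)
        (hI.continuousOn_mul (Continuous.continuousOn (by fun_prop))) (hI.const_mul T)
        fun s hs => mul_le_mul_of_nonneg_right (by linarith [hs.2])
          ((h.posSemidef s).quadratic_nonneg _)
    rw [intervalIntegral.integral_const_mul] at h1
    have h2 := h.energy_sub hy (t - T) t
    have hback : y (t - T) = transitionMatrix (fun t => -(B * Q t)) (t - T) t *ᵥ y t := by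
      refine congrFun (hy.unique h.measurable_rate hK (h.isTrajectory t (y t)) (a := t) ?_) (t - T)
      simp only [transitionMatrix_self, Matrix.one_mulVec]
    have hcoord : ∀ i, y (t - T) i * y (t - T) i ≤ R * (y t ⬝ᵥ y t) := by
      intro i
      have h3 : |y (t - T) i| ≤ Fintype.card ι * Real.exp (Fintype.card ι * K * T) *
          Real.sqrt (y t ⬝ᵥ y t) := by
        rw [hback]
        refine abs_mulVec_le (fun i j => abs_transitionMatrix_le h.measurable_rate hK
          (by simp [abs_of_pos hT]) i j) (fun j => ?_) i
        exact Real.abs_le_sqrt (sq_le_dotProduct_self _ j)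
      have h4 := pow_le_pow_left₀ (abs_nonneg _) h3 2
      rw [mul_pow _ (Real.sqrt _), Real.sq_sqrt (dotProduct_self_nonneg' _), sq_abs] at h4
      rw [← sq]; exact h4
    have h5 : y (t - T) ⬝ᵥ y (t - T) ≤ Fintype.card ι * R * (y t ⬝ᵥ y t) := by
      refine (Finset.sum_le_sum fun i _ => hcoord i).trans_eq ?_
      simp [mul_assoc]
    have h6 := (dotProduct_mulVec_le_opNorm B⁻¹ (y (t - T))).trans
      (mul_le_mul_of_nonneg_left h5 hnn)
    have h7 := mul_le_mul_of_nonneg_left h6 (by positivity : 0 ≤ T / 2)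
    have h8 := dotProduct_self_nonneg' (y t)
    have h9 : T / 2 * (opNorm B⁻¹ * (Fintype.card ι * R * (y t ⬝ᵥ y t))) = c₂ * (y t ⬝ᵥ y t) := by
      rw [hc₂]; ring
    rw [h9] at h7
    have h10 : T * ∫ s in (t - T)..t, y s ⬝ᵥ Q s *ᵥ y s =
        T / 2 * (y (t - T) ⬝ᵥ B⁻¹ *ᵥ y (t - T)) - T / 2 * (y t ⬝ᵥ B⁻¹ *ᵥ y t) := by
      linear_combination T / 2 * h2
    linarith

end Lyapunov

/-! ### The theorem for the error system. -/

theorem theorem1 {n Ny N : ℕ}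
    -- the gains
    (Γ : Fin n → Matrix (Fin N) (Fin N) ℝ) (α : ℝ)
    (hΓ : ∀ i, (Γ i).PosDef) (hα : 0 < α)
    -- the regressors and the communication graph, as measurable functions of time
    (C : ℝ → Fin n → Matrix (Fin Ny) (Fin N) ℝ)
    (hC : ∀ i k l, Measurable fun t => C t i k l)
    (G : ℝ → SimpleGraph (Fin n)) (o : ∀ t, EdgeOrientation (G t))
    (hG : ∀ i j, MeasurableSet {t | (G t).Adj i j})
    -- cooperative persistent excitation
    (T ι₁ ι₁' : ℝ) (hT : 0 < T) (hι₁ : 0 < ι₁) (hι₁' : ι₁ ≤ ι₁')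
    (hPE : ∀ t, T ≤ t →
      (ι₁' • (1 : Matrix (Fin N) (Fin N) ℝ) - excitation C T t).PosSemidef ∧
      (excitation C T t - ι₁ • (1 : Matrix (Fin N) (Fin N) ℝ)).PosSemidef)
    -- bounded regressors
    (r₂ : ℝ) (hr₂ : 0 < r₂) (hCb : ∀ t, 0 ≤ t → ∀ i, opNorm ((C t i)ᵀ * C t i) ≤ r₂)
    -- connectedness on average, bounded Laplacian
    (lam : ℝ) (hlam : 0 < lam)
    (hconn : ∀ t, T ≤ t → ∃ i₀, (avgLaplacian_isHermitian G o T t).eigenvalues i₀ = 0 ∧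
      ∀ i, i ≠ i₀ → lam ≤ (avgLaplacian_isHermitian G o T t).eigenvalues i)
    (r₃ : ℝ) (hr₃ : 0 < r₃) (hLb : ∀ t, 0 ≤ t → opNorm (laplacian (o t)) ≤ r₃) :
    -- the matrix used in the Gramian and in `P` is the state transition matrix
    IsStateTransition (errorMatrix Γ α C G o) (transitionMatrix (errorMatrix Γ α C G o)) ∧
    IsGUAS (errorMatrix Γ α C G o) ∧
    IsStrongLyapunov (errorMatrix Γ α C G o) T
      (fun t x => quadForm (lyapunovMatrix Γ α C G o T t) x) ∧
    -- the derivative of `V` along solutions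
    (∀ t₀, 0 ≤ t₀ → ∀ x, IsSolution (errorMatrix Γ α C G o) t₀ x → ∀ t, max T t₀ ≤ t →
      HasDerivWithinAt (fun τ => quadForm (lyapunovMatrix Γ α C G o T τ) (x τ))
        (-quadForm (obsGramian Γ α C G o T t) (x t)) (Ici (max T t₀)) t) ∧
    -- the explicit lower bound on the Gramian
    0 < iotaThreeLower (iotaTwoUpper T α r₂ r₃) (iotaTwoLower n T α ι₁ r₂ lam)
      (opNorm (blockDiag Γ)) ∧
    (∀ t, T ≤ t → ∀ x : EuclideanSpace ℝ (Fin n × Fin N),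
      -quadForm (obsGramian Γ α C G o T t) x ≤
        -iotaThreeLower (iotaTwoUpper T α r₂ r₃) (iotaTwoLower n T α ι₁ r₂ lam)
          (opNorm (blockDiag Γ)) * ‖x‖ ^ 2) := by
  classical
  set A := errorMatrix Γ α C G o with hA_def
  set B := blockDiag Γ with hB_def
  -- The bounds hold only for t ≥ 0; extending by zero gives a globally bounded measurable
  -- coefficient without changing the system on [0, ∞).
  set Q : ℝ → Matrix (Fin n × Fin N) (Fin n × Fin N) ℝ :=
    fun t => if 0 ≤ t then outputGram α (C t) (o t) else 0 with hQ_def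
  set u := iotaTwoUpper T α r₂ r₃ with hu_def
  set l := iotaTwoLower n T α ι₁ r₂ lam with hl_def
  have hb : 0 < r₂ + α * r₃ := by positivity
  have hu : 0 < u := mul_pos hT hb
  have hn : 0 < n := by obtain ⟨i₀, -⟩ := hconn T le_rfl; exact Fin.pos i₀
  have hl : 0 < l := iotaTwoLower_pos hn hα hlam hι₁
  have hQ : EqOn (fun t => outputGram α (C t) (o t)) Q (Ici 0) := fun t ht =>
    (if_pos (mem_Ici.mp ht)).symm
  have hA : EqOn A (fun t => -(B * Q t)) (Ici 0) := fun t ht => by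
    simp only [hA_def, errorMatrix, ← hQ ht, hB_def]
  have h : IsGradientSystem B Q (r₂ + α * r₃) := by
    refine ⟨blockDiag_posDef hΓ, fun i j => ?_, fun t => ?_, hb, fun t v => ?_⟩
    · have hif : (fun t => Q t i j) = fun t => if 0 ≤ t then outputGram α (C t) (o t) i j else 0 := by
        ext t; simp only [hQ_def]; split_ifs <;> rfl
      rw [hif]
      exact Measurable.ite measurableSet_Ici (measurable_outputGram hC hG hα.le i j)
        measurable_const
    · simp only [hQ_def]
      split_ifs
      · exact outputGram_posSemidef _ _ _
      · exact Matrix.PosSemidef.zero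
    · simp only [hQ_def]
      split_ifs with ht
      · exact outputGram_quadratic_le hα.le (hCb t ht) (hLb t ht) v
      · simpa using mul_nonneg hb.le (dotProduct_self_nonneg' v)
  obtain ⟨K, hK⟩ := h.exists_rate_bound
  have hι₃ : 0 < iotaThreeLower u l (opNorm B) := iotaThreeLower_pos hu hl
  have hobs : ∀ y, IsTrajectory (fun t => -(B * Q t)) y → ∀ t, T ≤ t →
      iotaThreeLower u l (opNorm B) * (y t ⬝ᵥ y t) ≤
        ∫ s in (t - T)..t, y s ⬝ᵥ Q s *ᵥ y s := by
    intro y hy t ht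
    have hle : t - T ≤ t := by linarith
    have hnn : 0 ≤ ∫ s in (t - T)..t, y s ⬝ᵥ Q s *ᵥ y s :=
      intervalIntegral.integral_nonneg hle fun s _ => (h.posSemidef s).quadratic_nonneg _
    rcases (dotProduct_self_nonneg' (y t)).eq_or_lt with h0 | h0
    · rwa [← h0, mul_zero]
    have hexc : l * (y t ⬝ᵥ y t) ≤ ∫ s in (t - T)..t, y t ⬝ᵥ Q s *ᵥ y t := by
      obtain ⟨i₀, -, hgap⟩ := hconn t ht
      refine (iotaTwoLower_mul_le_integral_outputGram hα hT hC hG hr₂ hCb hr₃ hLb hlam ht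
        (hPE t ht).2 ⟨i₀, hgap⟩ (y t)).trans_eq ?_
      refine intervalIntegral.integral_congr fun s hs => ?_
      rw [uIcc_of_le hle] at hs
      have hs0 : s ∈ Ici (0 : ℝ) := mem_Ici.mpr (by linarith [hs.1])
      simp only [← hQ hs0]
    -- At a nonzero vector the lower and upper bounds for the frozen integral can be compared; this
    -- is why y(t) = 0 was treated separately.
    have hlu : l ≤ u := by
      refine le_of_mul_le_mul_right (hexc.trans ?_) h0
      have hmono := intervalIntegral.integral_mono_on hle
        (h.intervalIntegrable_quadratic (y := fun _ => y t) (fun _ => continuous_const) (t - T) t)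
        intervalIntegrable_const fun s _ => h.quadratic_le s (y t)
      rw [intervalIntegral.integral_const, sub_sub_cancel, smul_eq_mul, ← mul_assoc] at hmono
      exact hmono
    have hBpos : 0 < opNorm B := by
      obtain ⟨c, hc, hcB⟩ := h.posDef.exists_le_quadratic
      have := (hcB (y t)).trans (dotProduct_mulVec_le_opNorm B (y t))
      exact hc.trans_le (le_of_mul_le_mul_right this h0)
    have hO := h.observability hy hBpos hT hexc
    have hC3 := mul_le_mul_of_nonneg_right (iotaThreeLower_mul_le hBpos.le hl hlu) h0.le
    refine le_of_mul_le_mul_left ?_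
      (by positivity : 0 < (1 + opNorm B * u / Real.sqrt 2) ^ 2)
    refine le_trans (le_of_eq ?_) (hC3.trans hO)
    ring
  have hgram : ∀ t, T ≤ t → ∀ x : EuclideanSpace ℝ (Fin n × Fin N),
      quadForm (obsGramian Γ α C G o T t) x =
        ∫ s in (t - T)..t, (transitionMatrix (fun t => -(B * Q t)) s t *ᵥ x.ofLp) ⬝ᵥ
          Q s *ᵥ (transitionMatrix (fun t => -(B * Q t)) s t *ᵥ x.ofLp) := by
    intro t ht x
    have := h.quadForm_gramian hA hQ (c := fun _ => 1) continuous_const hT.le ht x.ofLp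
    simp only [one_smul, one_mul] at this
    exact this
  have hlyap : ∀ t, T ≤ t → ∀ x : EuclideanSpace ℝ (Fin n × Fin N),
      quadForm (lyapunovMatrix Γ α C G o T t) x = T / 2 * (x.ofLp ⬝ᵥ B⁻¹ *ᵥ x.ofLp) +
        ∫ s in (t - T)..t, (s - t + T) *
          ((transitionMatrix (fun t => -(B * Q t)) s t *ᵥ x.ofLp) ⬝ᵥ
          Q s *ᵥ (transitionMatrix (fun t => -(B * Q t)) s t *ᵥ x.ofLp)) := by
    intro t ht x
    have := h.quadForm_gramian hA hQ (c := fun s => s - t + T) (by fun_prop) hT.le ht x.ofLp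
    rw [← this, quadForm, lyapunovMatrix, Matrix.add_mulVec, dotProduct_add, Matrix.smul_mulVec,
      dotProduct_smul, smul_eq_mul]
    rfl
  have hlow : ∀ t, T ≤ t → ∀ x : EuclideanSpace ℝ (Fin n × Fin N),
      iotaThreeLower u l (opNorm B) * ‖x‖ ^ 2 ≤ quadForm (obsGramian Γ α C G o T t) x := by
    intro t ht x
    have := hobs _ (h.isTrajectory t x.ofLp) t ht
    rw [hgram t ht, EuclideanSpace.norm_sq_eq_dotProduct]
    simpa only [transitionMatrix_self, Matrix.one_mulVec] using this
  have hderiv : ∀ t₀, 0 ≤ t₀ → ∀ x, IsSolution A t₀ x → ∀ t, max T t₀ ≤ t →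
      HasDerivWithinAt (fun τ => quadForm (lyapunovMatrix Γ α C G o T τ) (x τ))
        (-quadForm (obsGramian Γ α C G o T t) (x t)) (Ici (max T t₀)) t := by
    intro t₀ ht₀ x hx t ht
    obtain ⟨y, hy, hyx, hyΦ⟩ := h.exists_trajectory (hx.congr hA ht₀)
    have hmain := hasDerivAt_energy_add_ramp (h.intervalIntegrable_quadratic hy.continuous)
      (E := fun t => y t ⬝ᵥ B⁻¹ *ᵥ y t) (h.energy_sub hy) T t
    have hV : ∀ τ, max T t₀ ≤ τ → quadForm (lyapunovMatrix Γ α C G o T τ) (x τ) =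
        T / 2 * (y τ ⬝ᵥ B⁻¹ *ᵥ y τ) +
          ∫ s in (τ - T)..τ, (s - τ + T) * (y s ⬝ᵥ Q s *ᵥ y s) := by
      intro τ hτ
      have h2 := (le_max_right _ _).trans hτ
      simp only [hlyap τ ((le_max_left _ _).trans hτ), hyΦ τ h2, hyx τ h2]
    have hM : quadForm (obsGramian Γ α C G o T t) (x t) =
        ∫ s in (t - T)..t, y s ⬝ᵥ Q s *ᵥ y s := by
      simp only [hgram t ((le_max_left _ _).trans ht), hyΦ t ((le_max_right _ _).trans ht)]
    rw [hM]
    exact hmain.hasDerivWithinAt.congr (fun τ hτ => hV τ hτ) (hV t ht)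
  refine ⟨isStateTransition_transitionMatrix h.measurable_rate hK hA,
    h.isGUAS hA hT hι₃ hobs, ?_, hderiv, hι₃, fun t ht x => ?_⟩
  · obtain ⟨c₁, c₂, hc₁, hc₂, hbd⟩ := h.exists_lyapunov_bounds hT
    refine ⟨c₁, c₂, _, hc₁, hc₂, hι₃, fun t ht x => ?_, fun t₀ ht₀ x hx t ht =>
      ⟨_, hderiv t₀ ht₀ x hx t ht, ?_⟩⟩
    · have := hbd _ (h.isTrajectory t x.ofLp) t
      simp only [transitionMatrix_self, Matrix.one_mulVec] at this
      rwa [← hlyap t ht, ← EuclideanSpace.norm_sq_eq_dotProduct] at this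
    · linarith [hlow t ((le_max_left _ _).trans ht) (x t)]
  · linarith [hlow t ht x]
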